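/- Let $(\Omega,\mathcal F,\mathbb F=\{\mathcal F_t\}_{t\in[0,1]},\mathbb P)$ be a filtered probability space and let $X=\{X(t),t\in[0,1]\}$ be a real-valued $\mathbb F$-adapted process. Assume: 1. (Hölder) there is $\alpha>\tfrac12$ such that almost surely there is a finite constant $C>0$ (possibly depending on $\omega$) with $|X(t)-X(s)|\le C|t-s|^{\alpha}$ for all $s,t\in[0,1]$; 2. (small ball) there are constants $\delta>0$ and $C>0$ such that for all $s<t$ in $[1-\delta,1]\cap[0,1]$, with $\Delta=t-s$, and all $0<\varepsilon\le\Delta^{\alpha}$, $$\mathbb P\Big(\sup_{s\le u\le t}|X(u)-X(s)|\le\varepsilon\Big)\le\exp\big(-C\Delta\,\varepsilon^{-1/\alpha}\big);$$ 3. there is $v\in(1-\delta,1)\cap[0,1]$ such that the distribution function of $X(v)$ is continuous. Then for every distribution function $F$ on $\mathbb R$ (non-decreasing, right-continuous, with limits $0$ at $-\infty$ and $1$ at $+\infty$) there exist $\beta\in(1-\alpha,1)$ and an $\mathbb F$-adapted process $\varphi=\{\varphi(t),t\in[0,1]\}$ such that, almost surely, the integral $\int_0^1\varphi(s)\,\mathrm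 dX(s)$ exists as a generalized Lebesgue–Stieltjes integral of order $\beta$, and this integral is a random variable with distribution function $F$. Here, for $\beta\in(0,1)$, $f,g\colon[a,b]\to\mathbb R$ and $g_{b-}(x)=g(x)-g(b)$, the generalized Lebesgue–Stieltjes integral is $$\int_a^b f\,\mathrm dg=e^{i\pi\beta}\int_a^b\big(D_{a+}^{\beta}f\big)(x)\,\big(D_{b-}^{1-\beta}g_{b-}\big)(x)\,\mathrm dx,$$ $$\big(D_{a+}^{\beta}f\big)(x)=\frac{1}{\Gamma(1-\beta)}\Big(\frac{f(x)}{(x-a)^{\beta}}+\beta\int_a^x\frac{f(x)-f(u)}{(x-u)^{\beta+1}}\,\mathrm du\Big),$$ $$\big(D_{b-}^{1-\beta}g\big)(x)=\frac{e^{i\pi(1-\beta)}}{\Gamma(\beta)}\Big(\frac{g(x)}{(b-x)^{1-\beta}}+(1-\beta)\int_x^b\frac{g(x)-g(u)}{(u-x)^{2-\beta}}\,\mathrm du\Big),$$ and it is said to exist if $f$ is measurable, $D_{a+}^{\beta}f\in L_1[a,b]$, $D_{b-}^{1-\beta}g_{b-}\in L_\infty[a,b]$ (the inner integrals converging absolutely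 for almost every $x$), and $$\int_a^b\Big(\frac{|f(t)|}{(t-a)^{\beta}}+\int_a^t\frac{|f(t)-f(s)|}{(t-s)^{\beta+1}}\,\mathrm ds\Big)\mathrm dt<\infty.$$ -/

import Mathlib

open MeasureTheory ProbabilityTheory Set Filter Topology
open scoped ENNReal unitInterval

noncomputable section

namespace GLS

/-- Left-sided fractional (Weyl) derivative `D_{a+}^β f` on an interval starting at `a`. -/
def leftDeriv (β a : ℝ) (f : ℝ → ℝ) (x : ℝ) : ℝ :=
  1 / Real.Gamma (1 - β) *
    (f x / (x - a) ^ β + β * ∫ u in Ioc a x, (f x - f u) / (x - u) ^ (β + 1))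

/-- Right-sided fractional (Weyl) derivative `D_{b-}^{1-β} g` on an interval ending at `b`,
with its customary complex phase `(-1)^{1-β} = e^{iπ(1-β)}`. -/
def rightDeriv (β b : ℝ) (g : ℝ → ℝ) (x : ℝ) : ℂ :=
  Complex.exp (Complex.I * Real.pi * (1 - β)) / (Real.Gamma β : ℂ) *
    ((g x / (b - x) ^ (1 - β) +
      (1 - β) * ∫ u in Ioc x b, (g x - g u) / (u - x) ^ (2 - β) : ℝ) : ℂ)

/-- The norm `‖f‖_{β;[a,b]}`, as an extended nonnegative number. -/
def fracNorm (β a b : ℝ) (f : ℝ → ℝ) : ℝ≥0∞ :=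
  ∫⁻ t in Ioc a b, (ENNReal.ofReal (|f t| / (t - a) ^ β) +
    ∫⁻ s in Ioc a t, ENNReal.ofReal (|f t - f s| / (t - s) ^ (β + 1)))

/-- The generalized Lebesgue-Stieltjes integral `∫_a^b f dg`, computed with the fractional
order `β`, exists (`f` being an admissible integrand of order `β`) and equals `J`. -/
structure HasIntegral (β a b : ℝ) (f g : ℝ → ℝ) (J : ℝ) : Prop where
  order_mem : β ∈ Ioo (0 : ℝ) 1
  aemeasurable : AEMeasurable f (volume.restrict (Ioc a b))
  /-- Admissibility; in particular the inner integral in `leftDeriv` converges absolutely for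
  almost every `x`. -/
  fracNorm_lt_top : fracNorm β a b f < ∞
  left_memLp : MemLp (leftDeriv β a f) 1 (volume.restrict (Ioc a b))
  /-- The inner integral in `rightDeriv` converges absolutely for almost every `x`. -/
  right_inner : ∀ᵐ x ∂(volume.restrict (Ioc a b)),
    IntegrableOn (fun u => (g x - g u) / (u - x) ^ (2 - β)) (Ioc x b)
  right_memLp : MemLp (rightDeriv β b (fun x => g x - g b)) ∞ (volume.restrict (Ioc a b))
  value : (J : ℂ) = Complex.exp (Complex.I * Real.pi * β) *
    ∫ x in Ioc a b, (leftDeriv β a f x : ℂ) * rightDeriv β b (fun x => g x - g b) x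

end GLS

/-- A path on `[0,1]` as a function on `ℝ` (constant outside `[0,1]`; only the values on `[0,1]`
enter integrals over `[0,1]`). -/
def extendPath {Ω : Type*} (X : I → Ω → ℝ) (ω : Ω) : ℝ → ℝ :=
  IccExtend zero_le_one (fun t : Icc (0 : ℝ) 1 => X t ω)

/-- Almost every path is Hölder continuous of order `α` on `[0,1]`. -/
def HolderPaths {Ω : Type*} [MeasurableSpace Ω] (P : Measure Ω) (X : I → Ω → ℝ) (α : ℝ) : Prop :=
  ∀ᵐ ω ∂P, ∃ C : ℝ, 0 < C ∧ ∀ s t : I, |X t ω - X s ω| ≤ C * |(t : ℝ) - s| ^ α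

/-- Small ball estimate on `[1-δ,1]`; the event is `sup_{s ≤ u ≤ t} |X(u) - X(s)| ≤ ε`. -/
def SmallBall {Ω : Type*} [MeasurableSpace Ω] (P : Measure Ω) (X : I → Ω → ℝ) (α δ : ℝ) : Prop :=
  ∃ C : ℝ, 0 < C ∧ ∀ s t : I, 1 - δ ≤ (s : ℝ) → s < t → ∀ ε : ℝ, 0 < ε →
    ε ≤ ((t : ℝ) - s) ^ α →
    P.real {ω | ∀ u ∈ Icc s t, |X u ω - X s ω| ≤ ε} ≤
      Real.exp (-C * ((t : ℝ) - s) * ε ^ (-(1 / α)))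

/-- `F` is the distribution function of a probability measure on `ℝ`. -/
structure IsDistributionFunction (F : ℝ → ℝ) : Prop where
  mono : Monotone F
  right_cont : ∀ x, ContinuousWithinAt F (Ici x) x
  tendsto_atBot : Tendsto F atBot (𝓝 0)
  tendsto_atTop : Tendsto F atTop (𝓝 1)

end

/-!
Smoothing a Hölder function `g` and integrating by parts identifies the right-sided Weyl derivative
of `g` with a fractional integral of its derivative; by Fubini and the Beta integral, the integral
of a step function against `g` is then the expected sum of increments. So piecewise constant
strategies are admissible integrands, and their gains are the elementary ones.

Choose consecutive blocks of time in `(v, 1)`. On each block, hold twice the displacement of the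
path since the start of the block, divided by the square of a level, until the displacement reaches
the level. Since `2 * y * dy = d(y ^ 2) - (dy) ^ 2`, the block then gains `1` up to the discrete
quadratic variation, which is negligible for fine cells because `α > 1 / 2`. By the small ball
estimate and the Borel-Cantelli lemma the level is almost surely reached on all but finitely many
blocks, so the total gain tends to `∞`. Stopping when it equals `|ξ|` and multiplying by the sign of
`ξ` yields the integral `ξ`, for any random variable `ξ` known at time `v`. As `X v` has a
continuous distribution function `G`, the variable `G (X v)` is uniform, and a function of it has
the prescribed distribution.
-/

noncomputable section

namespace GLS

/-! ### Power integrals and Fubini on a triangle -/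

section PowerIntegrals

theorem integrableOn_sub_left_rpow {r : ℝ} (hr : -1 < r) (a b : ℝ) :
    IntegrableOn (fun u => (u - a) ^ r) (Ioc a b) := by
  rcases le_or_gt a b with hab | hab
  · rw [← intervalIntegrable_iff_integrableOn_Ioc_of_le hab]
    simpa using
      (intervalIntegral.intervalIntegrable_rpow' hr (a := 0) (b := b - a)).comp_sub_right a
  · simp [Ioc_eq_empty (not_lt.2 hab.le)]

theorem setIntegral_sub_left_rpow {r : ℝ} (hr : -1 < r) {a b : ℝ} (hab : a ≤ b) :
    ∫ u in Ioc a b, (u - a) ^ r = (b - a) ^ (r + 1) / (r + 1) := by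
  rw [← intervalIntegral.integral_of_le hab,
    intervalIntegral.integral_comp_sub_right (fun u => u ^ r) a, integral_rpow (Or.inl hr)]
  simp [Real.zero_rpow (by linarith : r + 1 ≠ 0)]

theorem setIntegral_rpow_mul_sub_rpow {p q : ℝ} (hp : 0 < p) (hq : 0 < q) {c : ℝ} (hc : 0 < c) :
    ∫ y in Ioc 0 c, y ^ (p - 1) * (c - y) ^ (q - 1) = c ^ (p + q - 1) * beta p q := by
  apply Complex.ofReal_injective
  have hscaled := Complex.betaIntegral_scaled (p : ℂ) (q : ℂ) hc
  have hbeta : Complex.betaIntegral p q = (beta p q : ℂ) := by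
    rw [Complex.betaIntegral_eq_Gamma_mul_div _ _ (by simpa) (by simpa), beta]
    push_cast [← Complex.Gamma_ofReal]
    rfl
  rw [hbeta, intervalIntegral.integral_of_le hc.le] at hscaled
  rw [Complex.ofReal_mul, Complex.ofReal_cpow hc.le, ← integral_complex_ofReal]
  push_cast
  rw [← hscaled]
  refine setIntegral_congr_fun measurableSet_Ioc fun y hy => ?_
  rw [Complex.ofReal_cpow hy.1.le, Complex.ofReal_cpow (sub_nonneg.2 hy.2)]
  push_cast
  rfl

theorem setIntegral_sub_rpow_mul_sub_rpow {p q : ℝ} (hp : 0 < p) (hq : 0 < q) {s u : ℝ}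
    (hsu : s < u) :
    ∫ x in Ioc s u, (x - s) ^ (p - 1) * (u - x) ^ (q - 1) = (u - s) ^ (p + q - 1) * beta p q := by
  rw [← setIntegral_rpow_mul_sub_rpow hp hq (sub_pos.2 hsu),
    ← intervalIntegral.integral_of_le hsu.le, ← intervalIntegral.integral_of_le (sub_pos.2 hsu).le,
    ← sub_self s, ← intervalIntegral.integral_comp_sub_right _ s]
  simp

theorem integrableOn_sub_rpow_mul_sub_rpow {p q : ℝ} (hp : 0 < p) (hq : 0 < q) (s u : ℝ) :
    IntegrableOn (fun x => (x - s) ^ (p - 1) * (u - x) ^ (q - 1)) (Ioc s u) := by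
  rcases lt_or_ge s u with hsu | hsu
  · apply Integrable.of_integral_ne_zero
    rw [setIntegral_sub_rpow_mul_sub_rpow hp hq hsu]
    exact (mul_pos (Real.rpow_pos_of_pos (sub_pos.2 hsu) _) (beta_pos hp hq)).ne'
  · simp [Ioc_eq_empty (not_lt.2 hsu)]

end PowerIntegrals

section Triangle

variable {s b : ℝ} {E : Type*} [NormedAddCommGroup E]

/-- The triangle `{(x, u) | s < x < u ≤ b}`, on which the iterated integrals of fractional calculus
are interchanged. -/
def triangle (s b : ℝ) : Set (ℝ × ℝ) := {p | s < p.1 ∧ p.1 < p.2 ∧ p.2 ≤ b}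

theorem measurableSet_triangle : MeasurableSet (triangle s b) :=
  (measurableSet_lt measurable_const measurable_fst).inter
    ((measurableSet_lt measurable_fst measurable_snd).inter
      (measurableSet_le measurable_snd measurable_const))

theorem indicator_triangle_left (f : ℝ × ℝ → E) (x u : ℝ) :
    (triangle s b).indicator f (x, u) =
      (Ioc s b).indicator (fun x => (Ioc x b).indicator (fun u => f (x, u)) u) x := by
  simp only [indicator, triangle, mem_ofPred_eq, mem_Ioc]
  grind

theorem indicator_triangle_right (f : ℝ × ℝ → E) (x u : ℝ) :
    (triangle s b).indicator f (x, u) =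
      (Ioc s b).indicator (fun u => (Ioo s u).indicator (fun x => f (x, u)) x) u := by
  simp only [indicator, triangle, mem_ofPred_eq, mem_Ioc, mem_Ioo]
  grind

theorem integrableOn_triangle_iff {f : ℝ × ℝ → E} (hf : StronglyMeasurable f) :
    IntegrableOn f (triangle s b) ↔
      (∀ᵐ u ∂volume.restrict (Ioc s b), IntegrableOn (fun x => f (x, u)) (Ioc s u)) ∧
        IntegrableOn (fun u => ∫ x in Ioc s u, ‖f (x, u)‖) (Ioc s b) := by
  rw [← integrable_indicator_iff measurableSet_triangle, Measure.volume_eq_prod,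
    integrable_prod_iff' (hf.indicator measurableSet_triangle).aestronglyMeasurable,
    ae_restrict_iff' measurableSet_Ioc, ← integrable_indicator_iff measurableSet_Ioc]
  refine and_congr (eventually_congr (Eventually.of_forall fun u => ?_)) (integrable_congr
    (Eventually.of_forall fun u => ?_))
  · simp_rw [indicator_triangle_right]
    by_cases hu : u ∈ Ioc s b <;>
      simp [hu, integrable_indicator_iff measurableSet_Ioo, integrableOn_Ioc_iff_integrableOn_Ioo]
  · simp_rw [indicator_triangle_right]
    by_cases hu : u ∈ Ioc s b <;>
      simp [hu, norm_indicator_eq_indicator_norm, integral_indicator, integral_Ioc_eq_integral_Ioo]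

variable [NormedSpace ℝ E]

theorem setIntegral_setIntegral_triangle_swap {f : ℝ × ℝ → E} (hf : IntegrableOn f (triangle s b)) :
    ∫ x in Ioc s b, ∫ u in Ioc x b, f (x, u) = ∫ u in Ioc s b, ∫ x in Ioc s u, f (x, u) := by
  rw [← integral_indicator measurableSet_Ioc, ← integral_indicator measurableSet_Ioc]
  have hleft (x : ℝ) : (Ioc s b).indicator (fun x => ∫ u in Ioc x b, f (x, u)) x =
      ∫ u, (triangle s b).indicator f (x, u) := by
    simp_rw [indicator_triangle_left]
    by_cases hx : x ∈ Ioc s b <;> simp [hx, integral_indicator]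
  have hright (u : ℝ) : (Ioc s b).indicator (fun u => ∫ x in Ioc s u, f (x, u)) u =
      ∫ x, (triangle s b).indicator f (x, u) := by
    simp_rw [indicator_triangle_right]
    by_cases hu : u ∈ Ioc s b <;> simp [hu, integral_indicator, integral_Ioc_eq_integral_Ioo]
  simp_rw [hleft, hright]
  exact integral_integral_swap ((integrable_indicator_iff measurableSet_triangle).2 hf)

end Triangle

/-! ### Weyl derivatives of Hölder functions -/

/-- The real factor of the right-sided Weyl derivative `D_{b-}^{1-β} (g - g b)`, without the complex
phase and the Gamma normalisation. -/
def rightWeyl (β b : ℝ) (g : ℝ → ℝ) (x : ℝ) : ℝ :=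
  (g x - g b) / (b - x) ^ (1 - β) + (1 - β) * ∫ u in Ioc x b, (g x - g u) / (u - x) ^ (2 - β)

theorem rightDeriv_sub_const_eq (β b : ℝ) (g : ℝ → ℝ) (x : ℝ) :
    rightDeriv β b (fun x => g x - g b) x =
      Complex.exp (Complex.I * Real.pi * (1 - β)) / (Real.Gamma β : ℂ) *
        (rightWeyl β b g x : ℂ) := by
  simp [rightDeriv, rightWeyl]

theorem measurable_rightWeyl {g : ℝ → ℝ} (hg : Measurable g) (β b : ℝ) :
    Measurable (rightWeyl β b g) := by
  unfold rightWeyl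
  refine Measurable.add (by fun_prop) (Measurable.const_mul ?_ _)
  have hind (x : ℝ) : ∫ u in Ioc x b, (g x - g u) / (u - x) ^ (2 - β) =
      ∫ u, {p : ℝ × ℝ | p.1 < p.2 ∧ p.2 ≤ b}.indicator
        (fun p => (g p.1 - g p.2) / (p.2 - p.1) ^ (2 - β)) (x, u) := by
    rw [← integral_indicator measurableSet_Ioc]
    rfl
  simp_rw [hind]
  refine StronglyMeasurable.measurable (StronglyMeasurable.integral_prod_right' (ν := volume)
    (Measurable.stronglyMeasurable ?_))
  exact Measurable.indicator (by fun_prop) ((measurableSet_lt measurable_fst measurable_snd).inter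
    (measurableSet_le measurable_snd measurable_const))

section Holder

variable {g : ℝ → ℝ} {C α : NNReal} {β b x u : ℝ}

theorem abs_sub_mul_rpow_le_of_holderWith (hg : HolderWith C α g) (hxu : x < u) (r : ℝ) :
    |(g x - g u) * (u - x) ^ r| ≤ C * (u - x) ^ (α + r) := by
  have hpos : 0 < u - x := sub_pos.2 hxu
  have hdist := hg.dist_le x u
  rw [Real.dist_eq, Real.dist_eq, abs_sub_comm x, abs_of_pos hpos] at hdist
  rw [abs_mul, abs_of_pos (Real.rpow_pos_of_pos hpos r), Real.rpow_add hpos, ← mul_assoc]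
  gcongr

theorem abs_sub_div_rpow_le_of_holderWith (hg : HolderWith C α g) (hxu : x < u) (r : ℝ) :
    |(g x - g u) / (u - x) ^ r| ≤ C * (u - x) ^ (α - r) := by
  rw [div_eq_mul_inv, ← Real.rpow_neg (sub_pos.2 hxu).le, sub_eq_add_neg (α : ℝ)]
  exact abs_sub_mul_rpow_le_of_holderWith hg hxu (-r)

theorem integrableOn_sub_div_rpow (hα : 0 < α) (hβ : 1 - α < β) (hg : HolderWith C α g) (x b : ℝ) :
    IntegrableOn (fun u => (g x - g u) / (u - x) ^ (2 - β)) (Ioc x b) := by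
  have hgm := (hg.continuous hα).measurable
  refine ((integrableOn_sub_left_rpow (r := α - (2 - β)) (by linarith) x b).const_mul C).mono'
    (Measurable.aestronglyMeasurable (by fun_prop)) ?_
  filter_upwards [self_mem_ae_restrict measurableSet_Ioc] with u hu
  exact abs_sub_div_rpow_le_of_holderWith hg hu.1 _

theorem abs_rightWeyl_le (hβ : 1 - α < β) (hβ1 : β ≤ 1) (hg : HolderWith C α g) (hx : x < b) :
    |rightWeyl β b g x| ≤ C * (1 + (1 - β) / (α + β - 1)) * (b - x) ^ (α + β - 1) := by
  have hboundary : |(g x - g b) / (b - x) ^ (1 - β)| ≤ C * (b - x) ^ (α + β - 1) := by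
    convert abs_sub_div_rpow_le_of_holderWith hg hx (1 - β) using 3
    ring
  have hintegral : |∫ u in Ioc x b, (g x - g u) / (u - x) ^ (2 - β)| ≤
      C * ((b - x) ^ (α + β - 1) / (α + β - 1)) := by
    rw [← Real.norm_eq_abs]
    refine (norm_integral_le_of_norm_le (g := fun u => C * (u - x) ^ (α - (2 - β)))
      ((integrableOn_sub_left_rpow (by linarith) x b).const_mul _) ?_).trans_eq ?_
    · filter_upwards [self_mem_ae_restrict measurableSet_Ioc] with u hu
      exact abs_sub_div_rpow_le_of_holderWith hg hu.1 _
    · rw [integral_const_mul, setIntegral_sub_left_rpow (by linarith) hx.le,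
        show α - (2 - β) + 1 = α + β - 1 by ring]
  calc |rightWeyl β b g x|
      ≤ C * (b - x) ^ (α + β - 1) + (1 - β) * (C * ((b - x) ^ (α + β - 1) / (α + β - 1))) := by
        refine (abs_add_le _ _).trans (add_le_add hboundary ?_)
        rw [abs_mul, abs_of_nonneg (sub_nonneg.2 hβ1)]
        exact mul_le_mul_of_nonneg_left hintegral (sub_nonneg.2 hβ1)
    _ = _ := by ring

theorem continuousOn_sub_mul_rpow (hα : 0 < α) (hβ : 1 - α < β) (hg : HolderWith C α g) (x : ℝ) :
    ContinuousOn (fun u => (g x - g u) * (u - x) ^ (β - 1)) (Ici x) := by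
  have hgc := hg.continuous hα
  intro u hu
  rcases (mem_Ici.1 hu).eq_or_lt with rfl | hxu
  · have hbound : ContinuousWithinAt (fun u => C * (u - x) ^ (α + (β - 1))) (Ici x) x :=
      ((by fun_prop : ContinuousWithinAt (fun u => u - x) (Ici x) x).rpow_const
        (Or.inr (by linarith))).const_mul _
    rw [ContinuousWithinAt, sub_self, zero_mul]
    rw [ContinuousWithinAt, sub_self, Real.zero_rpow (by linarith), mul_zero] at hbound
    refine squeeze_zero_norm' ?_ hbound
    filter_upwards [self_mem_nhdsWithin] with u hu
    rcases (mem_Ici.1 hu).eq_or_lt with rfl | hxu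
    · simp [Real.zero_rpow (by linarith : (α : ℝ) + (β - 1) ≠ 0)]
    · exact abs_sub_mul_rpow_le_of_holderWith hg hxu _
  · have hpow : ContinuousAt (fun u => (u - x) ^ (β - 1)) u :=
      (continuous_sub_right x).continuousAt.rpow_const (Or.inl (sub_pos.2 hxu).ne')
    exact ((continuous_const.sub hgc).continuousAt.mul hpow).continuousWithinAt

end Holder

section Inversion

variable {g g' : ℝ → ℝ} {C α : NNReal} {β b s x : ℝ}

theorem integrableOn_mul_sub_rpow (hβ0 : 0 < β) (hc : Continuous g') (x b : ℝ) :
    IntegrableOn (fun u => g' u * (u - x) ^ (β - 1)) (Ioc x b) := by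
  rcases le_or_gt x b with hxb | hxb
  · have hpow := integrableOn_sub_left_rpow (r := β - 1) (by linarith) x b
    rw [← intervalIntegrable_iff_integrableOn_Ioc_of_le hxb] at hpow ⊢
    exact hpow.continuousOn_mul hc.continuousOn
  · simp [Ioc_eq_empty (not_lt.2 hxb.le)]

/- Integration by parts: the boundary term of `rightWeyl` is the increment of
`u ↦ (g x - g u) (u - x) ^ (β - 1)`, which vanishes at `x` by Hölder continuity. -/
theorem rightWeyl_eq_neg_setIntegral_deriv (hα : 0 < α) (hβ0 : 0 < β) (hβ : 1 - α < β)
    (hg : HolderWith C α g) (hd : ∀ x, HasDerivAt g (g' x) x) (hc : Continuous g') (hx : x < b) :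
    rightWeyl β b g x = -∫ u in Ioc x b, g' u * (u - x) ^ (β - 1) := by
  have hderiv : ∀ u ∈ Ioo x b, HasDerivAt (fun u => (g x - g u) * (u - x) ^ (β - 1))
      (-(g' u * (u - x) ^ (β - 1)) - (1 - β) * ((g x - g u) / (u - x) ^ (2 - β))) u := by
    intro u hu
    have hpos : 0 < u - x := sub_pos.2 hu.1
    have hpow : HasDerivAt (fun u => (u - x) ^ (β - 1)) (1 * (β - 1) * (u - x) ^ (β - 1 - 1)) u :=
      ((hasDerivAt_id u).sub_const x).rpow_const (Or.inl hpos.ne')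
    refine (((hd u).const_sub (g x)).mul hpow).congr_deriv ?_
    rw [show β - 1 - 1 = -(2 - β) by ring, Real.rpow_neg hpos.le]
    ring
  have hint₁ : IntegrableOn (fun u => -(g' u * (u - x) ^ (β - 1))) (Ioc x b) :=
    (integrableOn_mul_sub_rpow hβ0 hc x b).neg
  have hint₂ := (integrableOn_sub_div_rpow hα hβ hg x b).const_mul (1 - β)
  have hftc := intervalIntegral.integral_eq_sub_of_hasDerivAt_of_le hx.le
    ((continuousOn_sub_mul_rpow hα hβ hg x).mono Icc_subset_Ici_self) hderiv
    ((intervalIntegrable_iff_integrableOn_Ioc_of_le hx.le).2 (hint₁.sub hint₂))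
  have hboundary : (b - x) ^ (β - 1) = ((b - x) ^ (1 - β))⁻¹ := by
    rw [← Real.rpow_neg (sub_pos.2 hx).le, neg_sub]
  rw [intervalIntegral.integral_of_le hx.le, integral_sub hint₁ hint₂, integral_const_mul,
    hboundary] at hftc
  simp only [sub_self, zero_mul, sub_zero, integral_neg] at hftc
  rw [rightWeyl, div_eq_mul_inv, ← hftc]
  ring

theorem setIntegral_rpow_neg_mul_sub_rpow (hβ0 : 0 < β) (hβ1 : β < 1) {u : ℝ} (hsu : s < u) :
    ∫ x in Ioc s u, (x - s) ^ (-β) * (u - x) ^ (β - 1) = Real.Gamma (1 - β) * Real.Gamma β := by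
  have hbeta := setIntegral_sub_rpow_mul_sub_rpow (sub_pos.2 hβ1) hβ0 hsu
  simpa [beta, show 1 - β - 1 = -β by ring] using hbeta

theorem integrableOn_triangle_fractional_kernel (hβ0 : 0 < β) (hβ1 : β < 1) (hc : Continuous g')
    (s b : ℝ) :
    IntegrableOn (fun p : ℝ × ℝ => (p.1 - s) ^ (-β) * (p.2 - p.1) ^ (β - 1) * g' p.2)
      (triangle s b) := by
  have hm := hc.measurable
  rw [integrableOn_triangle_iff (Measurable.stronglyMeasurable (by fun_prop))]
  constructor
  · refine Eventually.of_forall fun u => Integrable.mul_const ?_ (g' u)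
    simpa only [IntegrableOn, show 1 - β - 1 = -β by ring] using
      integrableOn_sub_rpow_mul_sub_rpow (sub_pos.2 hβ1) hβ0 s u
  · have hbound : IntegrableOn (fun u => Real.Gamma (1 - β) * Real.Gamma β * |g' u|) (Ioc s b) :=
      (hc.abs.integrableOn_Ioc).const_mul _
    refine hbound.congr_fun (fun u hu => ?_) measurableSet_Ioc
    simp only
    rw [← setIntegral_rpow_neg_mul_sub_rpow hβ0 hβ1 hu.1, ← integral_mul_const]
    refine setIntegral_congr_fun measurableSet_Ioc fun x hx => ?_
    have hnonneg : 0 ≤ (x - s) ^ (-β) * (u - x) ^ (β - 1) :=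
      mul_nonneg (Real.rpow_nonneg (sub_nonneg.2 hx.1.le) _)
        (Real.rpow_nonneg (sub_nonneg.2 hx.2) _)
    simp only [norm_mul _ (g' u), Real.norm_of_nonneg hnonneg, Real.norm_eq_abs]

theorem setIntegral_rpow_neg_mul_rightWeyl_of_hasDerivAt (hα : 0 < α) (hβ0 : 0 < β) (hβ1 : β < 1)
    (hβ : 1 - α < β) (hg : HolderWith C α g) (hd : ∀ x, HasDerivAt g (g' x) x)
    (hc : Continuous g') (hs : s ≤ b) :
    ∫ x in Ioc s b, (x - s) ^ (-β) * rightWeyl β b g x =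
      Real.Gamma (1 - β) * Real.Gamma β * (g s - g b) := by
  calc ∫ x in Ioc s b, (x - s) ^ (-β) * rightWeyl β b g x
      = ∫ x in Ioo s b, -∫ u in Ioc x b, (x - s) ^ (-β) * (u - x) ^ (β - 1) * g' u := by
        rw [integral_Ioc_eq_integral_Ioo]
        refine setIntegral_congr_fun measurableSet_Ioo fun x hx => ?_
        rw [rightWeyl_eq_neg_setIntegral_deriv hα hβ0 hβ hg hd hc hx.2, mul_neg,
          ← integral_const_mul]
        simp_rw [mul_assoc, mul_comm (g' _)]
    _ = -∫ u in Ioc s b, ∫ x in Ioc s u, (x - s) ^ (-β) * (u - x) ^ (β - 1) * g' u := by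
        rw [integral_neg, ← integral_Ioc_eq_integral_Ioo, setIntegral_setIntegral_triangle_swap
          (integrableOn_triangle_fractional_kernel hβ0 hβ1 hc s b)]
    _ = -∫ u in Ioc s b, Real.Gamma (1 - β) * Real.Gamma β * g' u := by
        congr 1
        refine setIntegral_congr_fun measurableSet_Ioc fun u hu => ?_
        simp only [integral_mul_const, setIntegral_rpow_neg_mul_sub_rpow hβ0 hβ1 hu.1]
    _ = Real.Gamma (1 - β) * Real.Gamma β * (g s - g b) := by
        rw [integral_const_mul, ← intervalIntegral.integral_of_le hs,
          intervalIntegral.integral_eq_sub_of_hasDerivAt (fun x _ => hd x)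
            (hc.intervalIntegrable s b)]
        ring

end Inversion

section MovingAverage

variable {g : ℝ → ℝ} {C α : NNReal}

theorem holderWith_of_dist_le {X Y : Type*} [PseudoMetricSpace X] [PseudoMetricSpace Y] {f : X → Y}
    (h : ∀ x y, dist (f x) (f y) ≤ C * dist x y ^ (α : ℝ)) : HolderWith C α f := by
  intro x y
  rw [edist_nndist, edist_nndist, ← ENNReal.coe_rpow_of_nonneg _ α.coe_nonneg, ← ENNReal.coe_mul,
    ENNReal.coe_le_coe]
  exact_mod_cast h x y

/-- The average of `g` over `[x, x + ε]`: a smoothing of `g` with the same Hölder constant. -/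
def movingAverage (g : ℝ → ℝ) (ε x : ℝ) : ℝ := ∫ r in (0 : ℝ)..1, g (x + ε * r)

theorem hasDerivAt_movingAverage (hg : Continuous g) {ε : ℝ} (hε : ε ≠ 0) (x : ℝ) :
    HasDerivAt (movingAverage g ε) (ε⁻¹ * (g (x + ε) - g x)) x := by
  have hprimitive : movingAverage g ε =
      fun x => ε⁻¹ * ((∫ y in (0 : ℝ)..(x + ε), g y) - ∫ y in (0 : ℝ)..x, g y) := by
    ext x
    rw [movingAverage, intervalIntegral.integral_comp_add_mul g hε,
      ← intervalIntegral.integral_interval_sub_left (a := 0) (hg.intervalIntegrable _ _)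
        (hg.intervalIntegrable _ _)]
    simp
  rw [hprimitive]
  refine HasDerivAt.const_mul _ (HasDerivAt.sub ?_ ?_)
  · simpa using (hg.integral_hasStrictDerivAt 0 (x + ε)).hasDerivAt.comp_add_const x ε
  · exact (hg.integral_hasStrictDerivAt 0 x).hasDerivAt

theorem holderWith_movingAverage (hα : 0 < α) (hg : HolderWith C α g) (ε : ℝ) :
    HolderWith C α (movingAverage g ε) := by
  have hgc := hg.continuous hα
  refine holderWith_of_dist_le fun s t => ?_
  rw [dist_eq_norm, movingAverage, movingAverage, ← intervalIntegral.integral_sub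
    (Continuous.intervalIntegrable (by fun_prop) _ _)
    (Continuous.intervalIntegrable (by fun_prop) _ _)]
  have hbound (r : ℝ) : ‖g (s + ε * r) - g (t + ε * r)‖ ≤ C * dist s t ^ (α : ℝ) := by
    simpa [dist_eq_norm] using hg.dist_le (s + ε * r) (t + ε * r)
  simpa using intervalIntegral.norm_integral_le_of_norm_le_const (a := 0) (b := 1)
    fun r _ => hbound r

theorem tendsto_movingAverage (hg : Continuous g) (x : ℝ) :
    Tendsto (fun ε => movingAverage g ε x) (𝓝 0) (𝓝 (g x)) := by
  have hcont : Continuous fun ε => movingAverage g ε x := by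
    unfold movingAverage
    fun_prop
  simpa [movingAverage] using hcont.tendsto 0

end MovingAverage

section Limit

variable {g : ℝ → ℝ} {G : ℕ → ℝ → ℝ} {C α : NNReal} {β b s : ℝ}

theorem tendsto_rightWeyl (hα : 0 < α) (hβ : 1 - α < β) (hG : ∀ n, HolderWith C α (G n))
    (hlim : ∀ x, Tendsto (fun n => G n x) atTop (𝓝 (g x))) (x : ℝ) :
    Tendsto (fun n => rightWeyl β b (G n) x) atTop (𝓝 (rightWeyl β b g x)) := by
  refine Tendsto.add (((hlim x).sub (hlim b)).div_const _) (Tendsto.const_mul _ ?_)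
  refine tendsto_integral_of_dominated_convergence (fun u => C * (u - x) ^ (α - (2 - β)))
    (fun n => (integrableOn_sub_div_rpow hα hβ (hG n) x b).aestronglyMeasurable)
    ((integrableOn_sub_left_rpow (by linarith) x b).const_mul C) (fun n => ?_)
    (Eventually.of_forall fun u => ((hlim x).sub (hlim u)).div_const _)
  filter_upwards [self_mem_ae_restrict measurableSet_Ioc] with u hu
  exact abs_sub_div_rpow_le_of_holderWith (hG n) hu.1 _

theorem tendsto_setIntegral_rpow_neg_mul_rightWeyl (hα : 0 < α) (hβ : 1 - α < β) (hβ1 : β < 1)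
    (hG : ∀ n, HolderWith C α (G n)) (hlim : ∀ x, Tendsto (fun n => G n x) atTop (𝓝 (g x))) :
    Tendsto (fun n => ∫ x in Ioc s b, (x - s) ^ (-β) * rightWeyl β b (G n) x) atTop
      (𝓝 (∫ x in Ioc s b, (x - s) ^ (-β) * rightWeyl β b g x)) := by
  simp_rw [integral_Ioc_eq_integral_Ioo]
  refine tendsto_integral_of_dominated_convergence (fun x => (x - s) ^ (-β) *
      (C * (1 + (1 - β) / (α + β - 1)) * (b - s) ^ (α + β - 1)))
    (fun n => ?_) (((integrableOn_sub_left_rpow (by linarith) s b).mono_set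
      Ioo_subset_Ioc_self).mul_const _) (fun n => ?_)
    (Eventually.of_forall fun x => (tendsto_rightWeyl hα hβ hG hlim x).const_mul _)
  · have := measurable_rightWeyl ((hG n).continuous hα).measurable β b
    exact Measurable.aestronglyMeasurable (by fun_prop)
  · filter_upwards [self_mem_ae_restrict measurableSet_Ioo] with x hx
    have hratio : 0 ≤ (1 - β) / (α + β - 1) := div_nonneg (by linarith) (by linarith)
    have hpow : (b - x) ^ (α + β - 1) ≤ (b - s) ^ (α + β - 1) :=
      Real.rpow_le_rpow (by linarith [hx.2]) (by linarith [hx.1]) (by linarith)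
    have hkernel := Real.rpow_nonneg (sub_nonneg.2 hx.1.le) (-β)
    rw [norm_mul, Real.norm_of_nonneg hkernel]
    refine mul_le_mul_of_nonneg_left ((abs_rightWeyl_le hβ hβ1.le (hG n) hx.2).trans ?_) hkernel
    gcongr

theorem setIntegral_rpow_neg_mul_rightWeyl (hα : 0 < α) (hβ0 : 0 < β) (hβ1 : β < 1)
    (hβ : 1 - α < β) (hg : HolderWith C α g) (hs : s ≤ b) :
    ∫ x in Ioc s b, (x - s) ^ (-β) * rightWeyl β b g x =
      Real.Gamma (1 - β) * Real.Gamma β * (g s - g b) := by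
  have hgc := hg.continuous hα
  let G (n : ℕ) : ℝ → ℝ := movingAverage g (1 / ((n : ℝ) + 1))
  have hG (n : ℕ) : HolderWith C α (G n) := holderWith_movingAverage hα hg _
  have hlim (x : ℝ) : Tendsto (fun n => G n x) atTop (𝓝 (g x)) :=
    (tendsto_movingAverage hgc x).comp tendsto_one_div_add_atTop_nhds_zero_nat
  have hintegral (n : ℕ) : ∫ x in Ioc s b, (x - s) ^ (-β) * rightWeyl β b (G n) x =
      Real.Gamma (1 - β) * Real.Gamma β * (G n s - G n b) :=
    setIntegral_rpow_neg_mul_rightWeyl_of_hasDerivAt hα hβ0 hβ1 hβ (hG n)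
      (hasDerivAt_movingAverage hgc (Nat.one_div_pos_of_nat).ne') (by fun_prop) hs
  have hconv := tendsto_setIntegral_rpow_neg_mul_rightWeyl (s := s) (b := b) hα hβ hβ1 hG hlim
  simp_rw [hintegral] at hconv
  exact tendsto_nhds_unique hconv (((hlim s).sub (hlim b)).const_mul _)

end Limit

/-! ### Linearity of the integral -/

section Linearity

variable {β a b J J₁ J₂ : ℝ} {f f' f₁ f₂ g : ℝ → ℝ}

theorem ae_restrict_Ioc_left {x : ℝ} (hf : f =ᵐ[volume.restrict (Ioc a b)] f') (hx : x ∈ Ioc a b) :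
    f =ᵐ[volume.restrict (Ioc a x)] f' :=
  ae_restrict_of_ae_restrict_of_subset (Ioc_subset_Ioc_right hx.2) hf

theorem leftDeriv_congr_ae (hf : f =ᵐ[volume.restrict (Ioc a b)] f') :
    leftDeriv β a f =ᵐ[volume.restrict (Ioc a b)] leftDeriv β a f' := by
  filter_upwards [hf, ae_restrict_mem measurableSet_Ioc] with x hfx hx
  rw [leftDeriv, leftDeriv, hfx, integral_congr_ae]
  filter_upwards [ae_restrict_Ioc_left hf hx] with u hu
  rw [hu]

theorem fracNorm_congr_ae (hf : f =ᵐ[volume.restrict (Ioc a b)] f') :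
    fracNorm β a b f = fracNorm β a b f' := by
  refine lintegral_congr_ae ?_
  filter_upwards [hf, ae_restrict_mem measurableSet_Ioc] with x hfx hx
  rw [hfx]
  congr 1
  refine lintegral_congr_ae ?_
  filter_upwards [ae_restrict_Ioc_left hf hx] with u hu
  rw [hu]

theorem HasIntegral.congr_ae (h : HasIntegral β a b f g J)
    (hf : f =ᵐ[volume.restrict (Ioc a b)] f') : HasIntegral β a b f' g J where
  order_mem := h.order_mem
  aemeasurable := h.aemeasurable.congr hf
  fracNorm_lt_top := fracNorm_congr_ae hf ▸ h.fracNorm_lt_top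
  left_memLp := h.left_memLp.ae_eq (leftDeriv_congr_ae hf)
  right_inner := h.right_inner
  right_memLp := h.right_memLp
  value := by
    rw [h.value]
    congr 1
    refine integral_congr_ae ?_
    filter_upwards [leftDeriv_congr_ae hf] with x hx
    rw [hx]

theorem measurable_lintegral_increment (hf : Measurable f) (r a : ℝ) :
    Measurable fun t => ∫⁻ s in Ioc a t, ENNReal.ofReal (|f t - f s| / (t - s) ^ r) := by
  have hind (t : ℝ) : ∫⁻ s in Ioc a t, ENNReal.ofReal (|f t - f s| / (t - s) ^ r) =
      ∫⁻ s, {p : ℝ × ℝ | a < p.2 ∧ p.2 ≤ p.1}.indicator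
        (fun p => ENNReal.ofReal (|f p.1 - f p.2| / (p.1 - p.2) ^ r)) (t, s) := by
    rw [← lintegral_indicator measurableSet_Ioc]
    rfl
  simp_rw [hind]
  refine Measurable.lintegral_prod_right' (Measurable.indicator (by fun_prop) ?_)
  exact (measurableSet_lt measurable_const measurable_snd).inter
    (measurableSet_le measurable_snd measurable_fst)

theorem ae_integrableOn_increment (hf : Measurable f) (hfin : fracNorm β a b f < ∞) :
    ∀ᵐ x ∂volume.restrict (Ioc a b),
      IntegrableOn (fun u => (f x - f u) / (x - u) ^ (β + 1)) (Ioc a x) := by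
  have hinner : ∫⁻ t in Ioc a b, ∫⁻ s in Ioc a t,
      ENNReal.ofReal (|f t - f s| / (t - s) ^ (β + 1)) ≠ ∞ :=
    ((lintegral_mono fun _ => le_add_self).trans_lt hfin).ne
  filter_upwards [ae_lt_top (measurable_lintegral_increment hf (β + 1) a) hinner] with x hx
  refine ⟨Measurable.aestronglyMeasurable (by fun_prop), ?_⟩
  rw [hasFiniteIntegral_iff_norm]
  refine lt_of_eq_of_lt (setLIntegral_congr_fun measurableSet_Ioc fun u hu => ?_) hx
  rw [norm_div, Real.norm_eq_abs, Real.norm_of_nonneg (Real.rpow_nonneg (sub_nonneg.2 hu.2) _)]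

theorem leftDeriv_add_ae (hf₁ : Measurable f₁) (hf₂ : Measurable f₂)
    (hfin₁ : fracNorm β a b f₁ < ∞) (hfin₂ : fracNorm β a b f₂ < ∞) :
    leftDeriv β a (f₁ + f₂) =ᵐ[volume.restrict (Ioc a b)] leftDeriv β a f₁ + leftDeriv β a f₂ := by
  filter_upwards [ae_integrableOn_increment hf₁ hfin₁, ae_integrableOn_increment hf₂ hfin₂]
    with x h₁ h₂
  have hsplit (u : ℝ) : ((f₁ + f₂) x - (f₁ + f₂) u) / (x - u) ^ (β + 1) =
      (f₁ x - f₁ u) / (x - u) ^ (β + 1) + (f₂ x - f₂ u) / (x - u) ^ (β + 1) := by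
    simp only [Pi.add_apply]
    ring
  rw [Pi.add_apply, leftDeriv, leftDeriv, leftDeriv]
  simp_rw [hsplit]
  rw [integral_add h₁ h₂, Pi.add_apply]
  ring

theorem fracNorm_add_le (hf₁ : Measurable f₁) :
    fracNorm β a b (f₁ + f₂) ≤ fracNorm β a b f₁ + fracNorm β a b f₂ := by
  have hquot {y₁ y₂ d : ℝ} (hd : 0 ≤ d) : ENNReal.ofReal (|y₁ + y₂| / d) ≤
      ENNReal.ofReal (|y₁| / d) + ENNReal.ofReal (|y₂| / d) := by
    rw [← ENNReal.ofReal_add (by positivity) (by positivity), ← add_div]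
    gcongr
    exact abs_add_le _ _
  have hm := measurable_lintegral_increment hf₁ (β + 1) a
  unfold fracNorm
  rw [← lintegral_add_left (by fun_prop)]
  refine setLIntegral_mono' measurableSet_Ioc fun t ht => ?_
  rw [add_add_add_comm, ← lintegral_add_left (by fun_prop)]
  refine add_le_add (hquot (Real.rpow_nonneg (sub_nonneg.2 ht.1.le) _))
    (setLIntegral_mono' measurableSet_Ioc fun s hs => ?_)
  simp only [Pi.add_apply, add_sub_add_comm]
  exact hquot (Real.rpow_nonneg (sub_nonneg.2 hs.2) _)

theorem HasIntegral.add_of_measurable (hf₁ : Measurable f₁) (hf₂ : Measurable f₂)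
    (h₁ : HasIntegral β a b f₁ g J₁) (h₂ : HasIntegral β a b f₂ g J₂) :
    HasIntegral β a b (f₁ + f₂) g (J₁ + J₂) := by
  have hleft := leftDeriv_add_ae hf₁ hf₂ h₁.fracNorm_lt_top h₂.fracNorm_lt_top
  have hprod {f : ℝ → ℝ} {J : ℝ} (h : HasIntegral β a b f g J) : IntegrableOn
      (fun x => (leftDeriv β a f x : ℂ) * rightDeriv β b (fun x => g x - g b) x) (Ioc a b) :=
    (memLp_one_iff_integrable.1 h.left_memLp).ofReal.mul_of_top_left h.right_memLp
  refine ⟨h₁.order_mem, (hf₁.add hf₂).aemeasurable,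
    (fracNorm_add_le hf₁).trans_lt (ENNReal.add_lt_top.2 ⟨h₁.fracNorm_lt_top, h₂.fracNorm_lt_top⟩),
    (h₁.left_memLp.add h₂.left_memLp).ae_eq hleft.symm, h₁.right_inner, h₁.right_memLp, ?_⟩
  rw [Complex.ofReal_add, h₁.value, h₂.value, ← mul_add, ← integral_add (hprod h₁) (hprod h₂)]
  congr 1
  refine integral_congr_ae ?_
  filter_upwards [hleft] with x hx
  rw [hx, Pi.add_apply, Complex.ofReal_add, add_mul]

theorem HasIntegral.add (h₁ : HasIntegral β a b f₁ g J₁) (h₂ : HasIntegral β a b f₂ g J₂) :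
    HasIntegral β a b (f₁ + f₂) g (J₁ + J₂) :=
  ((h₁.congr_ae h₁.aemeasurable.ae_eq_mk).add_of_measurable h₁.aemeasurable.measurable_mk
    h₂.aemeasurable.measurable_mk (h₂.congr_ae h₂.aemeasurable.ae_eq_mk)).congr_ae
    (h₁.aemeasurable.ae_eq_mk.add h₂.aemeasurable.ae_eq_mk).symm

theorem leftDeriv_const_mul (c β a : ℝ) (f : ℝ → ℝ) :
    leftDeriv β a (fun t => c * f t) = fun x => c * leftDeriv β a f x := by
  ext x
  simp only [leftDeriv, ← mul_sub, mul_div_assoc, integral_const_mul]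
  ring

theorem fracNorm_const_mul (c β a b : ℝ) (f : ℝ → ℝ) :
    fracNorm β a b (fun t => c * f t) = ENNReal.ofReal |c| * fracNorm β a b f := by
  simp only [fracNorm, ← mul_sub, abs_mul, mul_div_assoc, ENNReal.ofReal_mul (abs_nonneg c),
    lintegral_const_mul' _ _ ENNReal.ofReal_ne_top, ← mul_add]

theorem HasIntegral.const_mul (c : ℝ) (h : HasIntegral β a b f g J) :
    HasIntegral β a b (fun t => c * f t) g (c * J) where
  order_mem := h.order_mem
  aemeasurable := h.aemeasurable.const_mul c
  fracNorm_lt_top := by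
    rw [fracNorm_const_mul]
    exact ENNReal.mul_lt_top ENNReal.ofReal_lt_top h.fracNorm_lt_top
  left_memLp := by
    rw [leftDeriv_const_mul]
    exact h.left_memLp.const_mul c
  right_inner := h.right_inner
  right_memLp := h.right_memLp
  value := by
    simp only [leftDeriv_const_mul, Complex.ofReal_mul, h.value, mul_assoc, integral_const_mul]
    ring

end Linearity

/-! ### Step functions as integrands -/

/-- The one-sided power kernel `(x - s)_+ ^ (-β)`, in terms of which the left-sided Weyl derivative
of a step function is expressed. -/
def powKernel (β s : ℝ) : ℝ → ℝ := (Ioi s).indicator fun x => (x - s) ^ (-β)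

section PowKernel

variable {β a b s : ℝ}

theorem setIntegral_powKernel_mul (ha : a ≤ s) (h : ℝ → ℝ) :
    ∫ x in Ioc a b, powKernel β s x * h x = ∫ x in Ioc s b, (x - s) ^ (-β) * h x := by
  simp only [powKernel, ← indicator_mul_left]
  rw [setIntegral_indicator measurableSet_Ioi, Ioc_inter_Ioi, sup_eq_right.2 ha]

theorem integrableOn_powKernel (hβ1 : β < 1) (ha : a ≤ s) :
    IntegrableOn (powKernel β s) (Ioc a b) := by
  rw [powKernel, IntegrableOn, integrable_indicator_iff measurableSet_Ioi, IntegrableOn,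
    Measure.restrict_restrict measurableSet_Ioi, inter_comm, Ioc_inter_Ioi, sup_eq_right.2 ha]
  exact integrableOn_sub_left_rpow (by linarith) s b

end PowKernel

section IndicatorIio

variable {β a b s x : ℝ}

theorem integrableOn_sub_right_rpow_of_lt (hsx : s < x) (r a : ℝ) :
    IntegrableOn (fun u => (x - u) ^ r) (Ioc a s) := by
  refine ((continuousOn_const.sub continuousOn_id).rpow_const fun u hu => Or.inl ?_
    : ContinuousOn _ (Icc a s)).integrableOn_Icc.mono_set Ioc_subset_Icc_self
  exact (sub_pos.2 (hu.2.trans_lt hsx)).ne'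

theorem setIntegral_sub_right_rpow_of_lt (hβ : 0 < β) (ha : a ≤ s) (hsx : s < x) :
    ∫ u in Ioc a s, (x - u) ^ (-(β + 1)) = β⁻¹ * ((x - s) ^ (-β) - (x - a) ^ (-β)) := by
  have hzero : (0 : ℝ) ∉ uIcc (x - s) (x - a) := by
    rw [uIcc_of_le (by linarith)]
    exact fun h => (sub_pos.2 hsx).not_ge h.1
  rw [← intervalIntegral.integral_of_le ha,
    intervalIntegral.integral_comp_sub_left (fun y => y ^ (-(β + 1))) x,
    integral_rpow (Or.inr ⟨by linarith, hzero⟩), show -(β + 1) + 1 = -β by ring]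
  field_simp
  ring

theorem indicator_Iio_sub_of_le (hsx : s ≤ x) (u : ℝ) :
    (Iio s).indicator 1 x - (Iio s).indicator 1 u = -(Iio s).indicator (1 : ℝ → ℝ) u := by
  simp [hsx]

theorem indicator_Iio_sub_of_lt {u : ℝ} (hux : u ≤ x) (hxs : x < s) :
    (Iio s).indicator 1 x - (Iio s).indicator (1 : ℝ → ℝ) u = 0 := by
  simp [hxs, hux.trans_lt hxs]

theorem setIntegral_indicator_Iio_increment (hβ : 0 < β) (ha : a ≤ s) (hsx : s < x) :
    ∫ u in Ioc a x, ((Iio s).indicator 1 x - (Iio s).indicator 1 u) / (x - u) ^ (β + 1) =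
      β⁻¹ * ((x - a) ^ (-β) - (x - s) ^ (-β)) := by
  have hind : EqOn
      (fun u => ((Iio s).indicator 1 x - (Iio s).indicator 1 u) / (x - u) ^ (β + 1))
      (fun u => -(Iio s).indicator (fun u => (x - u) ^ (-(β + 1))) u) (Ioc a x) := fun u hu => by
    simp only [indicator_Iio_sub_of_le hsx.le]
    simp only [indicator, Pi.one_apply, Real.rpow_neg (sub_nonneg.2 hu.2)]
    split_ifs <;> simp [neg_div]
  have hset : Ioc a x ∩ Iio s = Ioo a s := by grind
  rw [setIntegral_congr_fun measurableSet_Ioc hind, integral_neg,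
    setIntegral_indicator measurableSet_Iio, hset, ← integral_Ioc_eq_integral_Ioo,
    setIntegral_sub_right_rpow_of_lt hβ ha hsx]
  ring

theorem leftDeriv_indicator_Iio (hβ : 0 < β) (ha : a ≤ s) (hax : a < x) (hxs : x ≠ s) :
    leftDeriv β a ((Iio s).indicator 1) x =
      1 / Real.Gamma (1 - β) * (powKernel β a x - powKernel β s x) := by
  rcases lt_or_gt_of_ne hxs with hlt | hgt
  · have hzero : ∫ u in Ioc a x, ((Iio s).indicator 1 x - (Iio s).indicator (1 : ℝ → ℝ) u) /
        (x - u) ^ (β + 1) = 0 := setIntegral_eq_zero_of_forall_eq_zero fun u hu => by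
      rw [indicator_Iio_sub_of_lt hu.2 hlt, zero_div]
    rw [leftDeriv, hzero]
    simp [powKernel, hax, hlt, not_lt.2 hlt.le, Real.rpow_neg (sub_pos.2 hax).le]
  · rw [leftDeriv, setIntegral_indicator_Iio_increment hβ ha hgt]
    simp [powKernel, hax, hgt, not_lt.2 hgt.le, hβ.ne']

theorem lintegral_indicator_Iio_increment (hβ : 0 < β) (ha : a ≤ s) (hax : a < x) (hxs : x ≠ s) :
    ∫⁻ u in Ioc a x, ENNReal.ofReal
        (|(Iio s).indicator 1 x - (Iio s).indicator (1 : ℝ → ℝ) u| / (x - u) ^ (β + 1)) ≤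
      ENNReal.ofReal (β⁻¹ * powKernel β s x) := by
  rcases lt_or_gt_of_ne hxs with hlt | hgt
  · have hzero : EqOn (fun u => ENNReal.ofReal
        (|(Iio s).indicator 1 x - (Iio s).indicator (1 : ℝ → ℝ) u| / (x - u) ^ (β + 1)))
        (fun _ => 0) (Ioc a x) := fun u hu => by
      simp only [indicator_Iio_sub_of_lt hu.2 hlt, abs_zero, zero_div, ENNReal.ofReal_zero]
    rw [setLIntegral_congr_fun measurableSet_Ioc hzero, lintegral_zero]
    exact zero_le
  · have hind : EqOn (fun u => ENNReal.ofReal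
          (|(Iio s).indicator 1 x - (Iio s).indicator (1 : ℝ → ℝ) u| / (x - u) ^ (β + 1)))
        ((Iio s).indicator fun u => ENNReal.ofReal ((x - u) ^ (-(β + 1)))) (Ioc a x) :=
      fun u hu => by
        simp only [indicator_Iio_sub_of_le hgt.le, abs_neg]
        simp only [indicator, Pi.one_apply, Real.rpow_neg (sub_nonneg.2 hu.2)]
        split_ifs <;> simp
    rw [setLIntegral_congr_fun measurableSet_Ioc hind, setLIntegral_indicator measurableSet_Iio]
    calc ∫⁻ u in Iio s ∩ Ioc a x, ENNReal.ofReal ((x - u) ^ (-(β + 1)))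
        ≤ ∫⁻ u in Ioc a s, ENNReal.ofReal ((x - u) ^ (-(β + 1))) :=
          lintegral_mono_set fun u hu => ⟨hu.2.1, (mem_Iio.1 hu.1).le⟩
      _ = ENNReal.ofReal (β⁻¹ * ((x - s) ^ (-β) - (x - a) ^ (-β))) := by
          rw [← setIntegral_sub_right_rpow_of_lt hβ ha hgt, ofReal_integral_eq_lintegral_ofReal
            (integrableOn_sub_right_rpow_of_lt hgt _ a)]
          filter_upwards [self_mem_ae_restrict measurableSet_Ioc] with u hu
          exact Real.rpow_nonneg (by linarith [hu.2]) _
      _ ≤ ENNReal.ofReal (β⁻¹ * powKernel β s x) := by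
          have := Real.rpow_nonneg (sub_pos.2 hax).le (-β)
          rw [powKernel, indicator_of_mem (mem_Ioi.2 hgt)]
          gcongr
          linarith

theorem ae_restrict_ne (t : Set ℝ) (s : ℝ) : ∀ᵐ x ∂volume.restrict t, x ≠ s :=
  ae_restrict_of_ae (volume.ae_ne s)

theorem fracNorm_indicator_Iio_lt_top (hβ : 0 < β) (hβ1 : β < 1) (ha : a ≤ s) :
    fracNorm β a b ((Iio s).indicator 1) < ∞ := by
  have hbound : Integrable (fun x => powKernel β a x) (volume.restrict (Ioc a b)) :=
    integrableOn_powKernel hβ1 le_rfl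
  have hbound' : Integrable (fun x => β⁻¹ * powKernel β s x) (volume.restrict (Ioc a b)) :=
    (integrableOn_powKernel hβ1 ha).const_mul _
  calc fracNorm β a b ((Iio s).indicator 1)
      ≤ ∫⁻ x in Ioc a b, (ENNReal.ofReal (powKernel β a x) +
          ENNReal.ofReal (β⁻¹ * powKernel β s x)) := by
        refine lintegral_mono_ae ?_
        filter_upwards [self_mem_ae_restrict measurableSet_Ioc, ae_restrict_ne _ s] with x hx hxs
        refine add_le_add (ENNReal.ofReal_le_ofReal ?_)
          (lintegral_indicator_Iio_increment hβ ha hx.1 hxs)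
        rw [powKernel, indicator_of_mem (mem_Ioi.2 hx.1), Real.rpow_neg (sub_pos.2 hx.1).le,
          div_eq_mul_inv]
        refine mul_le_of_le_one_left (by positivity [sub_pos.2 hx.1]) ?_
        simp only [indicator]
        split_ifs <;> simp
    _ < ∞ := by
        rw [lintegral_add_left' hbound.aemeasurable.ennreal_ofReal]
        exact ENNReal.add_lt_top.2 ⟨hbound.lintegral_lt_top, hbound'.lintegral_lt_top⟩

end IndicatorIio

section HolderIntegrator

variable {g : ℝ → ℝ} {C α : NNReal} {a b r s β : ℝ}

theorem ae_abs_rightWeyl_le (hβ : 1 - α < β) (hβ1 : β ≤ 1) (hg : HolderWith C α g) (a b : ℝ) :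
    ∀ᵐ x ∂volume.restrict (Ioc a b), ‖rightWeyl β b g x‖ ≤
      C * (1 + (1 - β) / (α + β - 1)) * (b - a) ^ (α + β - 1) := by
  filter_upwards [self_mem_ae_restrict measurableSet_Ioc, ae_restrict_ne _ b] with x hx hxb
  have hlt : x < b := lt_of_le_of_ne hx.2 hxb
  have hratio : 0 ≤ (1 - β) / (α + β - 1) := div_nonneg (by linarith) (by linarith)
  have hpow : (b - x) ^ (α + β - 1) ≤ (b - a) ^ (α + β - 1) :=
    Real.rpow_le_rpow (sub_pos.2 hlt).le (by linarith [hx.1]) (by linarith)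
  refine (abs_rightWeyl_le hβ hβ1 hg hlt).trans ?_
  gcongr

theorem memLp_rightDeriv (hα : 0 < α) (hβ : 1 - α < β) (hβ1 : β ≤ 1) (hg : HolderWith C α g) :
    MemLp (rightDeriv β b fun x => g x - g b) ∞ (volume.restrict (Ioc a b)) := by
  have hm := measurable_rightWeyl (hg.continuous hα).measurable β b
  rw [funext (rightDeriv_sub_const_eq β b g)]
  refine MemLp.const_mul ?_ _
  refine memLp_top_of_bound (by fun_prop)
    (C * (1 + (1 - β) / (α + β - 1)) * (b - a) ^ (α + β - 1)) ?_
  filter_upwards [ae_abs_rightWeyl_le hβ hβ1 hg a b] with x hx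
  rwa [Complex.norm_real]

theorem exp_mul_integral_mul_rightDeriv (β a b : ℝ) (L g : ℝ → ℝ) :
    Complex.exp (Complex.I * Real.pi * β) *
        ∫ x in Ioc a b, (L x : ℂ) * rightDeriv β b (fun x => g x - g b) x =
      ((-(1 / Real.Gamma β * ∫ x in Ioc a b, L x * rightWeyl β b g x) : ℝ) : ℂ) := by
  have hphase : Complex.exp (Complex.I * Real.pi * β) * Complex.exp (Complex.I * Real.pi * (1 - β))
      = -1 := by
    rw [← Complex.exp_add, ← Complex.exp_pi_mul_I]
    ring_nf
  simp_rw [rightDeriv_sub_const_eq, mul_left_comm (_ : ℂ) (_ / _), ← Complex.ofReal_mul]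
  rw [integral_const_mul, integral_complex_ofReal, ← mul_assoc, mul_div_assoc', hphase]
  push_cast
  ring

theorem setIntegral_leftDeriv_indicator_Iio_mul_rightWeyl (hα : 0 < α) (hβ0 : 0 < β) (hβ1 : β < 1)
    (hβ : 1 - α < β) (hg : HolderWith C α g) (hs : s ∈ Icc a b) :
    ∫ x in Ioc a b, leftDeriv β a ((Iio s).indicator 1) x * rightWeyl β b g x =
      Real.Gamma β * (g a - g s) := by
  have hm := measurable_rightWeyl (hg.continuous hα).measurable β b
  have hint {s : ℝ} (hs : a ≤ s) :
      IntegrableOn (fun x => powKernel β s x * rightWeyl β b g x) (Ioc a b) :=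
    (integrableOn_powKernel hβ1 hs).mul_bdd hm.aestronglyMeasurable
      (ae_abs_rightWeyl_le hβ hβ1.le hg a b)
  have hΓ : Real.Gamma (1 - β) ≠ 0 := (Real.Gamma_pos_of_pos (sub_pos.2 hβ1)).ne'
  calc ∫ x in Ioc a b, leftDeriv β a ((Iio s).indicator 1) x * rightWeyl β b g x
      = ∫ x in Ioc a b, 1 / Real.Gamma (1 - β) *
          (powKernel β a x * rightWeyl β b g x - powKernel β s x * rightWeyl β b g x) := by
        refine integral_congr_ae ?_
        filter_upwards [self_mem_ae_restrict measurableSet_Ioc, ae_restrict_ne _ s] with x hx hxs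
        rw [leftDeriv_indicator_Iio hβ0 hs.1 hx.1 hxs]
        ring
    _ = Real.Gamma β * (g a - g s) := by
        rw [integral_const_mul, integral_sub (hint le_rfl) (hint hs.1),
          setIntegral_powKernel_mul le_rfl, setIntegral_powKernel_mul hs.1,
          setIntegral_rpow_neg_mul_rightWeyl hα hβ0 hβ1 hβ hg (hs.1.trans hs.2),
          setIntegral_rpow_neg_mul_rightWeyl hα hβ0 hβ1 hβ hg hs.2]
        field_simp
        ring

theorem hasIntegral_indicator_Iio (hα : 0 < α) (hβ0 : 0 < β) (hβ1 : β < 1) (hβ : 1 - α < β)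
    (hg : HolderWith C α g) (hs : s ∈ Icc a b) :
    HasIntegral β a b ((Iio s).indicator 1) g (g s - g a) where
  order_mem := ⟨hβ0, hβ1⟩
  aemeasurable := (measurable_one.indicator measurableSet_Iio).aemeasurable
  fracNorm_lt_top := fracNorm_indicator_Iio_lt_top hβ0 hβ1 hs.1
  left_memLp := by
    rw [memLp_one_iff_integrable]
    refine Integrable.congr (((integrableOn_powKernel hβ1 le_rfl).sub
      (integrableOn_powKernel hβ1 hs.1)).const_mul (1 / Real.Gamma (1 - β))) ?_
    filter_upwards [self_mem_ae_restrict measurableSet_Ioc, ae_restrict_ne _ s] with x hx hxs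
    rw [leftDeriv_indicator_Iio hβ0 hs.1 hx.1 hxs, Pi.sub_apply]
  right_inner := Eventually.of_forall fun x => integrableOn_sub_div_rpow hα hβ hg x b
  right_memLp := memLp_rightDeriv hα hβ hβ1.le hg
  value := by
    have hΓ : Real.Gamma β ≠ 0 := (Real.Gamma_pos_of_pos hβ0).ne'
    rw [exp_mul_integral_mul_rightDeriv,
      setIntegral_leftDeriv_indicator_Iio_mul_rightWeyl hα hβ0 hβ1 hβ hg hs]
    congr 1
    field_simp
    ring

theorem hasIntegral_indicator_Ico (hα : 0 < α) (hβ0 : 0 < β) (hβ1 : β < 1) (hβ : 1 - α < β)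
    (hg : HolderWith C α g) (hr : r ∈ Icc a b) (hs : s ∈ Icc a b) (hrs : r ≤ s) :
    HasIntegral β a b ((Ico r s).indicator 1) g (g s - g r) := by
  have hdiff := (hasIntegral_indicator_Iio hα hβ0 hβ1 hβ hg hs).add
    ((hasIntegral_indicator_Iio hα hβ0 hβ1 hβ hg hr).const_mul (-1))
  convert! hdiff using 1
  · ext x
    simp only [indicator, mem_Ico, mem_Iio, Pi.add_apply, Pi.one_apply]
    grind
  · ring

theorem hasIntegral_sum_indicator_Ico (hα : 0 < α) (hβ0 : 0 < β) (hβ1 : β < 1) (hβ : 1 - α < β)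
    (hg : HolderWith C α g) (hab : a ≤ b) {ι : Type*} (A : Finset ι) (c r s : ι → ℝ)
    (hr : ∀ i, r i ∈ Icc a b) (hs : ∀ i, s i ∈ Icc a b) (hrs : ∀ i, r i ≤ s i) :
    HasIntegral β a b (fun x => ∑ i ∈ A, c i * (Ico (r i) (s i)).indicator 1 x) g
      (∑ i ∈ A, c i * (g (s i) - g (r i))) := by
  classical
  induction A using Finset.induction_on with
  | empty =>
    have ha : a ∈ Icc a b := left_mem_Icc.2 hab
    simpa using (hasIntegral_indicator_Ico hα hβ0 hβ1 hβ hg ha ha le_rfl).const_mul 0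
  | insert i A hiA ih =>
    simp only [Finset.sum_insert hiA]
    have hi := hasIntegral_indicator_Ico hα hβ0 hβ1 hβ hg (hr i) (hs i) (hrs i)
    exact (hi.const_mul (c i)).add ih

end HolderIntegrator

/-! ### Stopped trading strategies -/

section FirstPassage

variable {f : ℝ → ℝ} {a b R : ℝ}

theorem exists_first_passage (hf : ContinuousOn f (Icc a b)) (hab : a ≤ b) (ha : f a ≤ R)
    (hb : R ≤ f b) : ∃ τ ∈ Icc a b, f τ = R ∧ ∀ w ∈ Ico a τ, f w < R := by
  obtain ⟨w, hw, hwR⟩ := intermediate_value_Icc hab hf ⟨ha, hb⟩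
  have hcompact : IsCompact (Icc a b ∩ f ⁻¹' {R}) :=
    isCompact_Icc.of_isClosed_subset (hf.preimage_isClosed_of_isClosed isClosed_Icc
      isClosed_singleton) inter_subset_left
  obtain ⟨τ, ⟨hτ, hτR⟩, hleast⟩ := hcompact.exists_isLeast ⟨w, hw, hwR⟩
  refine ⟨τ, hτ, hτR, fun w hw => not_le.1 fun hRw => ?_⟩
  have hwb : w ≤ b := hw.2.le.trans hτ.2
  obtain ⟨z, hz, hzR⟩ := intermediate_value_Icc hw.1 (hf.mono (Icc_subset_Icc_right hwb)) ⟨ha, hRw⟩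
  exact (hleast ⟨⟨hz.1, hz.2.trans hwb⟩, hzR⟩).not_gt (hz.2.trans_lt hw.2)

theorem iSup_rat_lt_coe_iff (hf : Continuous f) (hab : a ≤ b) :
    ⨆ q : ℚ, (f (min b (max a q)) : EReal) < R ↔ ∀ w ∈ Icc a b, f w < R := by
  constructor
  · intro h w hw
    have hclosed : IsClosed {y : ℝ | (f (min b (max a y)) : EReal) ≤
        ⨆ q : ℚ, (f (min b (max a q)) : EReal)} :=
      isClosed_le (continuous_coe_real_ereal.comp (by fun_prop)) continuous_const
    have hrat : range ((↑) : ℚ → ℝ) ⊆ {y : ℝ | (f (min b (max a y)) : EReal) ≤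
        ⨆ q : ℚ, (f (min b (max a q)) : EReal)} :=
      range_subset_iff.2 fun q => le_iSup (fun q : ℚ => (f (min b (max a q)) : EReal)) q
    have hle := hclosed.closure_subset_iff.2 hrat (Rat.denseRange_cast w)
    rw [mem_ofPred_eq, max_eq_right hw.1, min_eq_right hw.2] at hle
    exact EReal.coe_lt_coe_iff.1 (hle.trans_lt h)
  · intro h
    obtain ⟨w, hw, hmax⟩ := isCompact_Icc.exists_isMaxOn (nonempty_Icc.2 hab) hf.continuousOn
    refine lt_of_le_of_lt (iSup_le fun q => ?_) (EReal.coe_lt_coe_iff.2 (h w hw))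
    exact EReal.coe_le_coe_iff.2 (hmax ⟨le_min hab (le_max_left _ _), min_le_left _ _⟩)

end FirstPassage

/-- A sequence of consecutive blocks `[node n, node (n + 1)]`, the `n`-th of which is divided into
`steps n` cells of equal length. Piecewise constant strategies rebalance at the division points. -/
structure BlockGrid where
  node : ℕ → ℝ
  steps : ℕ → ℕ
  node_strictMono : StrictMono node
  steps_pos : ∀ n, 0 < steps n

namespace BlockGrid

variable (S : BlockGrid)

/-- The common length of the cells of the `n`-th block. -/
def mesh (n : ℕ) : ℝ := (S.node (n + 1) - S.node n) / S.steps n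

/-- The left endpoint of the `j`-th cell of the `n`-th block. -/
def pt (n j : ℕ) : ℝ := S.node n + j * S.mesh n

/-- The cells of the first `N` blocks, each given by its block and its position in the block. -/
def cells (N : ℕ) : Finset (Σ _ : ℕ, ℕ) := (Finset.range N).sigma fun n => Finset.range (S.steps n)

theorem mesh_pos (n : ℕ) : 0 < S.mesh n :=
  div_pos (sub_pos.2 (S.node_strictMono n.lt_succ_self)) (Nat.cast_pos.2 (S.steps_pos n))

theorem steps_mul_mesh (n : ℕ) : S.steps n * S.mesh n = S.node (n + 1) - S.node n :=
  mul_div_cancel₀ _ (Nat.cast_ne_zero.2 (S.steps_pos n).ne')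

theorem pt_zero (n : ℕ) : S.pt n 0 = S.node n := by simp [pt]

theorem pt_steps (n : ℕ) : S.pt n (S.steps n) = S.node (n + 1) := by
  rw [pt, steps_mul_mesh, add_sub_cancel]

theorem pt_mono (n : ℕ) : Monotone (S.pt n) := fun i j hij => by
  have := (S.mesh_pos n).le
  unfold pt
  gcongr

theorem pt_succ_sub (n j : ℕ) : S.pt n (j + 1) - S.pt n j = S.mesh n := by
  simp only [pt]
  push_cast
  ring

theorem node_le_pt {N n : ℕ} (h : N ≤ n) (j : ℕ) : S.node N ≤ S.pt n j :=
  (S.node_strictMono.monotone h).trans (S.pt_zero n ▸ S.pt_mono n (Nat.zero_le j))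

theorem pt_le_node {N n j : ℕ} (h : n < N) (hj : j ≤ S.steps n) : S.pt n j ≤ S.node N :=
  (S.pt_mono n hj).trans (S.pt_steps n ▸ S.node_strictMono.monotone h)

theorem exists_abs_sub_pt_le {n : ℕ} {u : ℝ} (hu : u ∈ Icc (S.node n) (S.node (n + 1))) :
    ∃ j ≤ S.steps n, |u - S.pt n j| ≤ S.mesh n := by
  have hmesh := S.mesh_pos n
  have hr : 0 ≤ (u - S.node n) / S.mesh n := div_nonneg (sub_nonneg.2 hu.1) hmesh.le
  have hlow := (le_div_iff₀ hmesh).1 (Nat.floor_le hr)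
  have hup := (div_lt_iff₀ hmesh).1 (Nat.lt_floor_add_one ((u - S.node n) / S.mesh n))
  refine ⟨⌊(u - S.node n) / S.mesh n⌋₊, Nat.floor_le_of_le ?_, ?_⟩
  · rw [div_le_iff₀ hmesh, steps_mul_mesh]
    linarith [hu.2]
  · rw [pt, abs_le]
    constructor <;> linarith

theorem cells_zero : S.cells 0 = ∅ := rfl

theorem cells_mono : Monotone S.cells := fun _ _ h =>
  Finset.sigma_mono (Finset.range_mono h) fun _ => le_rfl

theorem le_fst_of_notMem_cells {N M : ℕ} {p : Σ _ : ℕ, ℕ} (hM : p ∈ S.cells M)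
    (hN : p ∉ S.cells N) : N ≤ p.1 := by
  simp only [cells, Finset.mem_sigma, Finset.mem_range] at hM hN
  lia

section Gain

variable (c : ℕ → ℕ → ℝ) (x : ℝ → ℝ)

/-- The gain up to time `u` from trading the path `x` in the first `N` blocks, when the position
held on the `j`-th cell of the `n`-th block is `c n j`. -/
def gain (N : ℕ) (u : ℝ) : ℝ :=
  ∑ p ∈ S.cells N, c p.1 p.2 * (x (min u (S.pt p.1 (p.2 + 1))) - x (min u (S.pt p.1 p.2)))

/-- The position held at time `u`, liquidated after the first `N` blocks. -/
def position (N : ℕ) (u : ℝ) : ℝ :=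
  ∑ p ∈ S.cells N, c p.1 p.2 * (Ico (S.pt p.1 p.2) (S.pt p.1 (p.2 + 1))).indicator 1 u

/-- The number of blocks that matter at time `u`; it is `0` if `u` lies beyond all blocks. -/
def horizon (u : ℝ) : ℕ := sInf {n | u < S.node n}

open Classical in
/-- The position at time `u` of the strategy `c`, liquidated as soon as its gain reaches `R`. The
supremum runs over countably many times so that this is an adapted process even where the paths
are not continuous. -/
def stopped (R u : ℝ) : ℝ :=
  if ⨆ q : ℚ, (S.gain c x (S.horizon u) (min u (max (S.node 0) q)) : EReal) < R then
    S.position c (S.horizon u) u else 0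

variable {c x} {N M : ℕ} {R u τ : ℝ}

theorem gain_eq_of_le (hNM : N ≤ M) (hu : u ≤ S.node N) : S.gain c x M u = S.gain c x N u := by
  refine (Finset.sum_subset (S.cells_mono hNM) fun p hM hN => ?_).symm
  have hpt (j : ℕ) : u ≤ S.pt p.1 j := hu.trans (S.node_le_pt (S.le_fst_of_notMem_cells hM hN) j)
  rw [min_eq_left (hpt _), min_eq_left (hpt _), sub_self, mul_zero]

theorem gain_node_zero (N : ℕ) : S.gain c x N (S.node 0) = 0 := by
  rw [S.gain_eq_of_le N.zero_le le_rfl]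
  simp [gain, cells_zero]

theorem gain_node (N : ℕ) : S.gain c x N (S.node N) = ∑ n ∈ Finset.range N,
    ∑ j ∈ Finset.range (S.steps n), c n j * (x (S.pt n (j + 1)) - x (S.pt n j)) := by
  rw [gain, cells, Finset.sum_sigma]
  refine Finset.sum_congr rfl fun n hn => Finset.sum_congr rfl fun j hj => ?_
  rw [Finset.mem_range] at hn hj
  rw [min_eq_right (S.pt_le_node hn hj), min_eq_right (S.pt_le_node hn hj.le)]

theorem continuous_gain (hx : Continuous x) (N : ℕ) : Continuous (S.gain c x N) := by
  unfold gain
  fun_prop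

theorem position_eq_of_lt (hNM : N ≤ M) (hu : u < S.node N) :
    S.position c M u = S.position c N u := by
  refine (Finset.sum_subset (S.cells_mono hNM) fun p hM hN => ?_).symm
  have hpt := hu.trans_le (S.node_le_pt (S.le_fst_of_notMem_cells hM hN) p.2)
  rw [indicator_of_notMem fun h => h.1.not_gt hpt, mul_zero]

theorem position_eq_zero (hu : u < S.node 0) (N : ℕ) : S.position c N u = 0 := by
  rw [S.position_eq_of_lt N.zero_le hu]
  simp [position, cells_zero]

theorem horizon_le (hu : u < S.node N) : S.horizon u ≤ N := Nat.sInf_le hu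

theorem lt_node_horizon (hu : u < S.node N) : u < S.node (S.horizon u) :=
  Nat.sInf_mem (s := {n | u < S.node n}) ⟨N, hu⟩

theorem horizon_eq_zero (hu : ∀ n, S.node n ≤ u) : S.horizon u = 0 := by
  have hempty : {n | u < S.node n} = ∅ := eq_empty_of_forall_notMem fun n hn => (hu n).not_gt hn
  rw [horizon, hempty, Nat.sInf_empty]

theorem stopped_eq_zero_of_lt (hu : u < S.node 0) : S.stopped c x R u = 0 := by
  rw [stopped, S.position_eq_zero hu, ite_self]

theorem stopped_of_forall_lt (hx : Continuous x) (hu : u < S.node N)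
    (hlt : ∀ w ∈ Icc (S.node 0) u, S.gain c x N w < R) :
    S.stopped c x R u = S.position c N u := by
  rcases lt_or_ge u (S.node 0) with h0 | h0
  · rw [S.stopped_eq_zero_of_lt h0, S.position_eq_zero h0]
  have hhor := S.horizon_le hu
  have hnode := S.lt_node_horizon hu
  rw [stopped, if_pos, S.position_eq_of_lt hhor hnode]
  rw [iSup_rat_lt_coe_iff (S.continuous_gain hx _) h0]
  intro w hw
  rw [← S.gain_eq_of_le hhor (hw.2.trans hnode.le)]
  exact hlt w hw

theorem stopped_of_gain_eq (hx : Continuous x) (hτ : τ ∈ Icc (S.node 0) (S.node N))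
    (hgain : S.gain c x N τ = R) (hu : τ ≤ u) : S.stopped c x R u = 0 := by
  by_cases hend : ∀ n, S.node n ≤ u
  · simp [stopped, position, cells_zero, S.horizon_eq_zero hend]
  push Not at hend
  obtain ⟨M, hM⟩ := hend
  have hnode := hu.trans (S.lt_node_horizon hM).le
  rw [stopped, if_neg]
  rw [iSup_rat_lt_coe_iff (S.continuous_gain hx _) (hτ.1.trans hu)]
  intro hlt
  refine (hlt τ ⟨hτ.1, hu⟩).ne ?_
  rw [← hgain, ← S.gain_eq_of_le (le_max_left _ N) hnode, S.gain_eq_of_le (le_max_right _ N) hτ.2]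

theorem stopped_eq_sum (hx : Continuous x) (hτ : τ ∈ Icc (S.node 0) (S.node N))
    (hgain : S.gain c x N τ = R) (hlt : ∀ w ∈ Ico (S.node 0) τ, S.gain c x N w < R) (u : ℝ) :
    S.stopped c x R u = ∑ p ∈ S.cells N,
      c p.1 p.2 * (Ico (min τ (S.pt p.1 p.2)) (min τ (S.pt p.1 (p.2 + 1)))).indicator 1 u := by
  rcases lt_or_ge u τ with hu | hu
  · rw [S.stopped_of_forall_lt hx (hu.trans_le hτ.2) fun w hw => hlt w ⟨hw.1, hw.2.trans_lt hu⟩]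
    refine Finset.sum_congr rfl fun p _ => ?_
    simp [indicator, hu, hu.not_ge]
  · rw [S.stopped_of_gain_eq hx hτ hgain hu]
    refine (Finset.sum_eq_zero fun p _ => ?_).symm
    simp [indicator, hu.not_gt]

theorem hasIntegral_stopped {C α : NNReal} {β a b : ℝ} (hα : 0 < α) (hβ0 : 0 < β) (hβ1 : β < 1)
    (hβ : 1 - α < β) (hx : HolderWith C α x) (hnode : ∀ n, S.node n ∈ Icc a b) (hR : 0 ≤ R)
    (hgain : R ≤ S.gain c x N (S.node N)) : HasIntegral β a b (S.stopped c x R) x R := by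
  have hcont := hx.continuous hα
  obtain ⟨τ, hτ, hτR, hlt⟩ := exists_first_passage (S.continuous_gain hcont N).continuousOn
    (S.node_strictMono.monotone N.zero_le) ((S.gain_node_zero N).trans_le hR) hgain
  have hab : a ≤ b := (hnode 0).1.trans (hnode 0).2
  have hmem (n j : ℕ) : min τ (S.pt n j) ∈ Icc a b :=
    ⟨(hnode 0).1.trans (le_min hτ.1 (S.node_le_pt n.zero_le j)),
      (min_le_left _ _).trans (hτ.2.trans (hnode N).2)⟩
  rw [funext (S.stopped_eq_sum hcont hτ hτR hlt), ← hτR]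
  exact hasIntegral_sum_indicator_Ico hα hβ0 hβ1 hβ hx hab (S.cells N) (fun p => c p.1 p.2)
    (fun p => min τ (S.pt p.1 p.2)) (fun p => min τ (S.pt p.1 (p.2 + 1))) (fun p => hmem _ _)
    (fun p => hmem _ _) fun p => min_le_min_left _ (S.pt_mono p.1 p.2.le_succ)

end Gain

section Measurability

variable {Ω : Type*} {mΩ : MeasurableSpace Ω} {c : Ω → ℕ → ℕ → ℝ} {x : Ω → ℝ → ℝ} {T : ℝ}

theorem measurable_gain (hc : ∀ n j, S.pt n j ≤ T → Measurable fun ω => c ω n j)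
    (hx : ∀ u ≤ T, Measurable fun ω => x ω u) {u : ℝ} (hu : u ≤ T) (N : ℕ) :
    Measurable fun ω => S.gain (c ω) (x ω) N u := by
  refine Finset.measurable_fun_sum _ fun p _ => ?_
  rcases le_or_gt (S.pt p.1 p.2) T with h | h
  · exact (hc _ _ h).mul ((hx _ (min_le_of_left_le hu)).sub (hx _ (min_le_of_left_le hu)))
  · have hle := hu.trans h.le
    simp only [min_eq_left hle, min_eq_left (hle.trans (S.pt_mono p.1 p.2.le_succ)), sub_self,
      mul_zero, measurable_const]

theorem measurable_position (hc : ∀ n j, S.pt n j ≤ T → Measurable fun ω => c ω n j) (N : ℕ) :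
    Measurable fun ω => S.position (c ω) N T := by
  refine Finset.measurable_fun_sum _ fun p _ => ?_
  rcases le_or_gt (S.pt p.1 p.2) T with h | h
  · exact (hc _ _ h).mul_const _
  · simp only [indicator_of_notMem fun hT : T ∈ Ico _ _ => hT.1.not_gt h, mul_zero,
      measurable_const]

theorem measurable_stopped (hc : ∀ n j, S.pt n j ≤ T → Measurable fun ω => c ω n j)
    (hx : ∀ u ≤ T, Measurable fun ω => x ω u) {R : Ω → ℝ} (hR : Measurable R) :
    Measurable fun ω => S.stopped (c ω) (x ω) (R ω) T := by
  refine Measurable.ite (measurableSet_lt (Measurable.iSup fun q => ?_) hR.coe_real_ereal)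
    (S.measurable_position hc _) measurable_const
  exact (S.measurable_gain hc hx (min_le_left _ _) _).coe_real_ereal

end Measurability

end BlockGrid

/-! ### The excursion strategy -/

theorem sum_range_two_mul_sub_mul_sub {R : Type*} [CommRing R] (y : ℕ → R) (m : ℕ) :
    ∑ j ∈ Finset.range m, 2 * (y j - y 0) * (y (j + 1) - y j) =
      (y m - y 0) ^ 2 - ∑ j ∈ Finset.range m, (y (j + 1) - y j) ^ 2 := by
  induction m with
  | zero => simp
  | succ m ih =>
    rw [Finset.sum_range_succ, Finset.sum_range_succ, ih]
    ring

theorem sq_sub_le_sum_range_stopped (y : ℕ → ℝ) {m : ℕ} {l e : ℝ} (hl : 0 ≤ l)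
    (hy : ∃ j ≤ m, l ≤ |y j - y 0|) (he : ∀ j < m, |y (j + 1) - y j| ≤ e) :
    l ^ 2 - m * e ^ 2 ≤ ∑ j ∈ Finset.range m,
      (if ∀ i ≤ j, |y i - y 0| < l then 2 * (y j - y 0) else 0) * (y (j + 1) - y j) := by
  classical
  obtain ⟨k, ⟨hkm, hk⟩, hfirst⟩ := Nat.findX hy
  have hbefore {j : ℕ} (hj : j < k) : ∀ i ≤ j, |y i - y 0| < l := fun i hi =>
    not_le.1 fun h => hfirst i (hi.trans_lt hj) ⟨(hi.trans hj.le).trans hkm, h⟩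
  have hstopped : ∑ j ∈ Finset.range m,
      (if ∀ i ≤ j, |y i - y 0| < l then 2 * (y j - y 0) else 0) * (y (j + 1) - y j) =
      ∑ j ∈ Finset.range k, 2 * (y j - y 0) * (y (j + 1) - y j) := by
    rw [← Finset.sum_subset (Finset.range_mono hkm)]
    · exact Finset.sum_congr rfl fun j hj => by rw [if_pos (hbefore (Finset.mem_range.1 hj))]
    · intro j _ hj
      rw [if_neg fun h => (h k (by simpa using hj)).not_ge hk, zero_mul]
  have hvar : ∑ j ∈ Finset.range k, (y (j + 1) - y j) ^ 2 ≤ m * e ^ 2 := calc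
    _ ≤ ∑ j ∈ Finset.range m, (y (j + 1) - y j) ^ 2 :=
        Finset.sum_le_sum_of_subset_of_nonneg (Finset.range_mono hkm) fun _ _ _ => sq_nonneg _
    _ ≤ ∑ _j ∈ Finset.range m, e ^ 2 := Finset.sum_le_sum fun _ hj =>
        sq_le_sq' (neg_le_of_abs_le (he _ (Finset.mem_range.1 hj)))
          (le_of_abs_le (he _ (Finset.mem_range.1 hj)))
    _ = m * e ^ 2 := by simp
  have hlevel : l ^ 2 ≤ (y k - y 0) ^ 2 := sq_abs (y k - y 0) ▸ pow_le_pow_left₀ hl hk 2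
  rw [hstopped, sum_range_two_mul_sub_mul_sub]
  exact sub_le_sub hlevel hvar

theorem tendsto_natCast_mul_div_rpow_sq {α D : ℝ} (hα : 1 / 2 < α) (hD : 0 ≤ D) :
    Tendsto (fun m : ℕ => m * ((D / m) ^ α) ^ 2) atTop (𝓝 0) := by
  have hlim : Tendsto (fun m : ℕ => (D ^ α) ^ 2 * (m : ℝ) ^ (-(2 * α - 1))) atTop (𝓝 0) := by
    simpa using ((tendsto_rpow_neg_atTop (sub_pos.2 (by linarith : 1 < 2 * α))).comp
      tendsto_natCast_atTop_atTop).const_mul ((D ^ α) ^ 2)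
  refine hlim.congr' ?_
  filter_upwards [eventually_gt_atTop 0] with m hm
  have hm' : (0 : ℝ) < m := Nat.cast_pos.2 hm
  rw [Real.div_rpow hD hm'.le, div_pow, neg_sub, Real.rpow_sub hm', Real.rpow_one, mul_comm 2 α,
    Real.rpow_mul hm'.le, Real.rpow_two]
  ring

theorem tendsto_sum_range_atTop_of_eventually_le {f : ℕ → ℝ} {r : ℝ} (hr : 0 < r)
    (hf : ∀ᶠ n in atTop, r ≤ f n) :
    Tendsto (fun N => ∑ n ∈ Finset.range N, f n) atTop atTop := by
  obtain ⟨K, hK⟩ := eventually_atTop.1 hf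
  rw [← tendsto_add_atTop_iff_nat K]
  refine tendsto_atTop_mono (fun N => ?_) (tendsto_atTop_add_const_left _
    (∑ n ∈ Finset.range K, f n) (tendsto_natCast_atTop_atTop.atTop_mul_const hr))
  have hsum := Finset.card_nsmul_le_sum (Finset.range N) (fun i => f (K + i)) r
    fun i _ => hK _ (Nat.le_add_right K i)
  rw [Finset.card_range, nsmul_eq_mul] at hsum
  rw [add_comm N, Finset.sum_range_add]
  gcongr

namespace BlockGrid

variable (S : BlockGrid) {n : ℕ}

/-- Half the small-ball radius `(|block n| / (n + 1)) ^ α`: the displacement at which the excursion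
strategy closes its position on the `n`-th block. -/
def level (α : ℝ) (n : ℕ) : ℝ := ((S.node (n + 1) - S.node n) / (n + 1)) ^ α / 2

open Classical in
/-- The excursion strategy: on each block, the position is proportional to the displacement of the
path `x` from the start of the block, until this displacement reaches `level`. -/
def excursion (α : ℝ) (x : ℝ → ℝ) (n j : ℕ) : ℝ :=
  (if ∀ i ≤ j, |x (S.pt n i) - x (S.pt n 0)| < S.level α n then
    2 * (x (S.pt n j) - x (S.pt n 0)) else 0) / S.level α n ^ 2

/-- The cells are so small that the quadratic variation of an `α`-Hölder path along the division
points of a block is negligible compared with the square of its level. -/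
def IsFine (α : ℝ) : Prop :=
  ∀ n : ℕ, (n + 1) * (S.steps n * (S.mesh n ^ α) ^ 2) ≤ S.level α n ^ 2

theorem level_pos (α : ℝ) (n : ℕ) : 0 < S.level α n := by
  have := sub_pos.2 (S.node_strictMono n.lt_succ_self)
  unfold level
  positivity

theorem exists_isFine {α a b : ℝ} (hα : 1 / 2 < α) (hab : a < b) :
    ∃ S : BlockGrid, (∀ n, S.node n ∈ Ioo a b) ∧ S.IsFine α := by
  obtain ⟨t, ht, hmem, -⟩ := exists_seq_strictMono_tendsto' hab
  have hlen (n : ℕ) : 0 < t (n + 1) - t n := sub_pos.2 (ht n.lt_succ_self)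
  have hsteps (n : ℕ) : ∃ m : ℕ, 0 < m ∧ (n + 1) * (m * (((t (n + 1) - t n) / m) ^ α) ^ 2) ≤
      (((t (n + 1) - t n) / (n + 1)) ^ α / 2) ^ 2 := by
    have hlim := (tendsto_natCast_mul_div_rpow_sq hα (hlen n).le).const_mul ((n : ℝ) + 1)
    rw [mul_zero] at hlim
    have hpos : 0 < (((t (n + 1) - t n) / (n + 1)) ^ α / 2) ^ 2 := by
      have := hlen n
      positivity
    exact ((eventually_gt_atTop 0).and (hlim.eventually_le_const hpos)).exists
  choose m hm hfine using hsteps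
  exact ⟨⟨t, m, ht, hm⟩, hmem, hfine⟩

variable {S} {x : ℝ → ℝ} {C α : NNReal}

theorem abs_sub_pt_le_of_holderWith (hx : HolderWith C α x) {s t : ℝ} (h : |s - t| ≤ S.mesh n) :
    |x s - x t| ≤ C * S.mesh n ^ (α : ℝ) := by
  rw [← Real.dist_eq] at h ⊢
  exact hx.dist_le_of_le h

theorem IsFine.steps_mul_sq_le (hS : S.IsFine α) (hn : 2 * (C : ℝ) ^ 2 ≤ n + 1) :
    S.steps n * (C * S.mesh n ^ (α : ℝ)) ^ 2 ≤ S.level α n ^ 2 / 2 := by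
  have hvar : 0 ≤ S.steps n * (S.mesh n ^ (α : ℝ)) ^ 2 := by positivity
  nlinarith [hS n, mul_le_mul_of_nonneg_right hn hvar]

theorem IsFine.mul_mesh_rpow_le (hS : S.IsFine α) (hn : 2 * (C : ℝ) ^ 2 ≤ n + 1) :
    C * S.mesh n ^ (α : ℝ) ≤ S.level α n := by
  have hsteps : (1 : ℝ) ≤ S.steps n := Nat.one_le_cast.2 (S.steps_pos n)
  refine abs_le_of_sq_le_sq' ?_ (S.level_pos α n).le |>.2
  nlinarith [hS.steps_mul_sq_le hn, sq_nonneg (C * S.mesh n ^ (α : ℝ)), sq_nonneg (S.level α n)]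

theorem IsFine.half_le_sum_excursion (hS : S.IsFine α) (hx : HolderWith C α x)
    (hn : 2 * (C : ℝ) ^ 2 ≤ n + 1) {u : ℝ} (hu : u ∈ Icc (S.node n) (S.node (n + 1)))
    (hexit : 2 * S.level α n < |x u - x (S.node n)|) :
    1 / 2 ≤ ∑ j ∈ Finset.range (S.steps n),
      S.excursion α x n j * (x (S.pt n (j + 1)) - x (S.pt n j)) := by
  have hreach : ∃ j ≤ S.steps n, S.level α n ≤ |x (S.pt n j) - x (S.pt n 0)| := by
    obtain ⟨j, hj, hju⟩ := S.exists_abs_sub_pt_le hu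
    have hclose := (abs_sub_pt_le_of_holderWith hx hju).trans (hS.mul_mesh_rpow_le hn)
    have htri := abs_sub_le (x u) (x (S.pt n j)) (x (S.node n))
    refine ⟨j, hj, ?_⟩
    rw [S.pt_zero]
    linarith
  have hstep (j : ℕ) : |x (S.pt n (j + 1)) - x (S.pt n j)| ≤ C * S.mesh n ^ (α : ℝ) :=
    abs_sub_pt_le_of_holderWith hx (by rw [S.pt_succ_sub, abs_of_pos (S.mesh_pos n)])
  have hpos := pow_pos (S.level_pos α n) 2
  have hgain := sq_sub_le_sum_range_stopped (fun j => x (S.pt n j)) (S.level_pos α n).le hreach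
    fun j _ => hstep j
  simp only [excursion, div_mul_eq_mul_div, ← Finset.sum_div]
  rw [le_div_iff₀ hpos]
  refine le_trans ?_ (hgain.trans_eq ?_)
  · linarith [hS.steps_mul_sq_le hn]
  · congr!

theorem IsFine.tendsto_gain_excursion (hS : S.IsFine α) (hx : HolderWith C α x)
    (hexit : ∀ᶠ n in atTop, ∃ u ∈ Icc (S.node n) (S.node (n + 1)),
      2 * S.level α n < |x u - x (S.node n)|) :
    Tendsto (fun N => S.gain (S.excursion α x) x N (S.node N)) atTop atTop := by
  have hlarge : ∀ᶠ n : ℕ in atTop, 2 * (C : ℝ) ^ 2 ≤ n + 1 :=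
    (tendsto_natCast_atTop_atTop.atTop_add tendsto_const_nhds).eventually_ge_atTop _
  simp_rw [S.gain_node]
  refine tendsto_sum_range_atTop_of_eventually_le one_half_pos ?_
  filter_upwards [hexit, hlarge] with n ⟨u, hu, hux⟩ hn
  exact hS.half_le_sum_excursion hx hn hu hux

section Measurability

variable {Ω : Type*} {mΩ : MeasurableSpace Ω} {x : Ω → ℝ → ℝ} {T : ℝ}

theorem measurable_excursion (hx : ∀ u ≤ T, Measurable fun ω => x ω u) (α : ℝ) {n j : ℕ}
    (hT : S.pt n j ≤ T) : Measurable fun ω => S.excursion α (x ω) n j := by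
  have hdiff (i : ℕ) (hi : i ≤ j) : Measurable fun ω => x ω (S.pt n i) - x ω (S.pt n 0) :=
    (hx _ ((S.pt_mono n hi).trans hT)).sub (hx _ ((S.pt_mono n j.zero_le).trans hT))
  refine (Measurable.ite ?_ ((hdiff j le_rfl).const_mul 2) measurable_const).div_const _
  simp only [ofPred_forall]
  exact MeasurableSet.iInter fun i => MeasurableSet.iInter fun hi =>
    measurableSet_lt (measurable_abs.comp (hdiff i hi)) measurable_const

end Measurability

end BlockGrid

/-! ### Adapted integrands with a prescribed integral -/

section Distribution

theorem exists_cdf_eq {μ : Measure ℝ} (hμ : Continuous (cdf μ)) {y : ℝ} (hy : y ∈ Ioo 0 1) :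
    ∃ z, cdf μ z = y := by
  obtain ⟨a, ha⟩ := ((tendsto_cdf_atBot μ).eventually_le_const hy.1).exists
  obtain ⟨b, hb⟩ := ((tendsto_cdf_atTop μ).eventually_const_le hy.2).exists
  exact mem_range_of_exists_le_of_exists_ge hμ ⟨a, ha⟩ ⟨b, hb⟩

theorem measureReal_cdf_le {μ : Measure ℝ} [IsProbabilityMeasure μ] (hμ : Continuous (cdf μ))
    {y : ℝ} (hy : y ∈ I) : μ.real {w | cdf μ w ≤ y} = y := by
  refine le_antisymm (le_of_forall_gt_imp_ge_of_dense fun r hr => ?_)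
    (le_of_forall_lt_imp_le_of_dense fun r hr => ?_)
  · rcases le_or_gt 1 r with h1 | h1
    · exact measureReal_le_one.trans h1
    obtain ⟨z, rfl⟩ := exists_cdf_eq hμ ⟨hy.1.trans_lt hr, h1⟩
    rw [cdf_eq_real μ z]
    exact measureReal_mono fun w hw => ((monotone_cdf μ).reflect_lt (hw.trans_lt hr)).le
  · rcases le_or_gt r 0 with h0 | h0
    · exact h0.trans measureReal_nonneg
    obtain ⟨z, rfl⟩ := exists_cdf_eq hμ ⟨h0, hr.trans_le hy.2⟩
    rw [cdf_eq_real μ z]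
    exact measureReal_mono fun w hw => (monotone_cdf μ hw).trans hr.le

theorem map_cdf_eq_volume {μ : Measure ℝ} [IsProbabilityMeasure μ] (hμ : Continuous (cdf μ)) :
    μ.map (fun w => (⟨cdf μ w, cdf_nonneg μ w, cdf_le_one μ w⟩ : I)) = volume := by
  have hmeas : Measurable fun w => (⟨cdf μ w, cdf_nonneg μ w, cdf_le_one μ w⟩ : I) :=
    (hμ.subtype_mk _).measurable
  have := Measure.isProbabilityMeasure_map (μ := μ) hmeas.aemeasurable
  refine Measure.ext_of_Iic _ _ fun y => ?_
  rw [Measure.map_apply hmeas measurableSet_Iic, unitInterval.volume_Iic,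
    ← measureReal_cdf_le hμ y.2, ofReal_measureReal]
  rfl

theorem exists_measurable_map_eq_of_continuous_cdf {μ : Measure ℝ} [IsProbabilityMeasure μ]
    (hμ : Continuous (cdf μ)) {Y : Type*} [MeasurableSpace Y] [Nonempty Y] [StandardBorelSpace Y]
    (ν : Measure Y) [IsProbabilityMeasure ν] : ∃ f : ℝ → Y, Measurable f ∧ μ.map f = ν := by
  obtain ⟨f, hf, hν⟩ := ν.exists_measurable_map_eq
  have hcdf : Measurable fun w => (⟨cdf μ w, cdf_nonneg μ w, cdf_le_one μ w⟩ : I) :=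
    (hμ.subtype_mk _).measurable
  exact ⟨_, hf.comp hcdf, by rw [← Measure.map_map hf hcdf, map_cdf_eq_volume hμ, hν]⟩

theorem exists_isProbabilityMeasure_cdf_eq {F : ℝ → ℝ} (hF : IsDistributionFunction F) :
    ∃ ν : Measure ℝ, IsProbabilityMeasure ν ∧ ∀ x, cdf ν x = F x := by
  let f : StieltjesFunction ℝ := ⟨F, hF.mono, hF.right_cont⟩
  refine ⟨f.measure, f.isProbabilityMeasure hF.tendsto_atBot hF.tendsto_atTop, fun x => ?_⟩
  rw [cdf_measure_stieltjesFunction f hF.tendsto_atBot hF.tendsto_atTop]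

end Distribution

section Paths

variable {Ω : Type*} {X : I → Ω → ℝ}

theorem extendPath_of_mem {u : ℝ} (hu : u ∈ I) (ω : Ω) : extendPath X ω u = X ⟨u, hu⟩ ω :=
  IccExtend_of_mem _ _ hu

theorem holderWith_extendPath {α : NNReal} {C : ℝ} (hC : 0 ≤ C) {ω : Ω}
    (h : ∀ s t : I, |X t ω - X s ω| ≤ C * |(t : ℝ) - s| ^ (α : ℝ)) :
    HolderWith C.toNNReal α (extendPath X ω) := by
  refine holderWith_of_dist_le fun t s => ?_
  rw [Real.dist_eq, Real.dist_eq, Real.coe_toNNReal C hC]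
  exact (h (projIcc 0 1 zero_le_one s) (projIcc 0 1 zero_le_one t)).trans
    (mul_le_mul_of_nonneg_left (Real.rpow_le_rpow (abs_nonneg _)
      (abs_projIcc_sub_projIcc zero_le_one) α.coe_nonneg) hC)

variable [mΩ : MeasurableSpace Ω]

theorem measurable_extendPath {𝓕 : Filtration I mΩ} (hX : Adapted 𝓕 X) (t : I) :
    ∀ u ≤ (t : ℝ), Measurable[𝓕 t] fun ω => extendPath X ω u := fun u hu => by
  have hproj : projIcc (0 : ℝ) 1 zero_le_one u ≤ t :=
    (monotone_projIcc zero_le_one hu).trans_eq (projIcc_val zero_le_one t)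
  exact (hX _).mono (𝓕.mono hproj) le_rfl

namespace BlockGrid

variable {P : Measure Ω} [IsFiniteMeasure P] {S : BlockGrid} {α δ : ℝ}

theorem exists_measureReal_forall_le_level_le (hα : 0 < α) (hball : SmallBall P X α δ)
    (hI : ∀ n, S.node n ∈ I) (hδ : ∀ n, 1 - δ ≤ S.node n) : ∃ C > 0, ∀ n,
    P.real {ω | ∀ u ∈ Icc (S.node n) (S.node (n + 1)),
      |extendPath X ω u - extendPath X ω (S.node n)| ≤ 2 * S.level α n} ≤
        Real.exp (-C) ^ (n + 1) := by
  obtain ⟨C, hC, hball⟩ := hball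
  refine ⟨C, hC, fun n => ?_⟩
  have hlt : S.node n < S.node (n + 1) := S.node_strictMono n.lt_succ_self
  have hlen : 0 < S.node (n + 1) - S.node n := sub_pos.2 hlt
  have hlevel : 2 * S.level α n = ((S.node (n + 1) - S.node n) / (n + 1)) ^ α :=
    mul_div_cancel₀ _ two_ne_zero
  have hle : 2 * S.level α n ≤ (S.node (n + 1) - S.node n) ^ α := by
    rw [hlevel]
    exact Real.rpow_le_rpow (by positivity)
      (div_le_self hlen.le (le_add_of_nonneg_left n.cast_nonneg)) hα.le
  have hpos : 0 < 2 * S.level α n := mul_pos two_pos (S.level_pos α n)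
  have hbound := hball ⟨_, hI n⟩ ⟨_, hI (n + 1)⟩ (hδ n) hlt _ hpos hle
  refine (measureReal_mono fun ω hω u hu => ?_).trans (hbound.trans_eq ?_)
  · have huI := hω u hu
    rwa [extendPath_of_mem (hI n), extendPath_of_mem u.2] at huI
  · rw [hlevel, ← Real.rpow_mul (by positivity), mul_neg, mul_one_div_cancel hα.ne',
      Real.rpow_neg_one, ← Real.exp_nat_mul]
    congr 1
    push_cast
    field_simp

theorem ae_eventually_exit (hα : 0 < α) (hball : SmallBall P X α δ)
    (hI : ∀ n, S.node n ∈ I) (hδ : ∀ n, 1 - δ ≤ S.node n) :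
    ∀ᵐ ω ∂P, ∀ᶠ n in atTop, ∃ u ∈ Icc (S.node n) (S.node (n + 1)),
      2 * S.level α n < |extendPath X ω u - extendPath X ω (S.node n)| := by
  obtain ⟨C, hC, hbound⟩ := exists_measureReal_forall_le_level_le hα hball hI hδ
  have hgeom : Summable fun n : ℕ => Real.exp (-C) ^ (n + 1) :=
    (summable_nat_add_iff 1).2 (summable_geometric_of_lt_one (Real.exp_pos _).le
      (Real.exp_lt_one_iff.2 (neg_lt_zero.2 hC)))
  have hsum : ∑' n, P {ω | ∀ u ∈ Icc (S.node n) (S.node (n + 1)),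
      |extendPath X ω u - extendPath X ω (S.node n)| ≤ 2 * S.level α n} ≠ ∞ := by
    refine ne_top_of_le_ne_top hgeom.tsum_ofReal_ne_top (ENNReal.tsum_le_tsum fun n => ?_)
    rw [← ofReal_measureReal]
    exact ENNReal.ofReal_le_ofReal (hbound n)
  filter_upwards [ae_eventually_notMem hsum] with ω hω
  filter_upwards [hω] with n hn
  simpa only [mem_ofPred_eq, not_forall, not_le, exists_prop] using hn

theorem ae_exists_gain_ge {α : NNReal} (hα : 0 < α) (hS : S.IsFine α) (hX : HolderPaths P X α)
    (hball : SmallBall P X α δ) (hI : ∀ n, S.node n ∈ I) (hδ : ∀ n, 1 - δ ≤ S.node n) :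
    ∀ᵐ ω ∂P, (∃ C, HolderWith C α (extendPath X ω)) ∧ ∀ R, ∃ N,
      R ≤ S.gain (S.excursion α (extendPath X ω)) (extendPath X ω) N (S.node N) := by
  filter_upwards [hX, ae_eventually_exit hα hball hI hδ] with ω ⟨C, hC, hω⟩ hexit
  have hholder := holderWith_extendPath hC.le hω
  exact ⟨⟨_, hholder⟩, fun R =>
    ((hS.tendsto_gain_excursion hholder hexit).eventually_ge_atTop R).exists⟩

end BlockGrid

theorem exists_adapted_hasIntegral_eq {P : Measure Ω} [IsFiniteMeasure P] {𝓕 : Filtration I mΩ}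
    (hX : Adapted 𝓕 X) {α β δ : ℝ} (hα : 1 / 2 < α) (hβ0 : 0 < β) (hβ1 : β < 1) (hβ : 1 - α < β)
    (hHolder : HolderPaths P X α) (hball : SmallBall P X α δ) {v : I}
    (hv : (v : ℝ) ∈ Ico (1 - δ) 1) {ξ : Ω → ℝ} (hξ : Measurable[𝓕 v] ξ) :
    ∃ φ : I → Ω → ℝ, Adapted 𝓕 φ ∧
      ∀ᵐ ω ∂P, HasIntegral β 0 1 (extendPath φ ω) (extendPath X ω) (ξ ω) := by
  lift α to NNReal using by linarith
  have hα0 : 0 < α := NNReal.coe_pos.1 (by linarith)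
  obtain ⟨S, hnode, hS⟩ := BlockGrid.exists_isFine hα hv.2
  have hI (n : ℕ) : S.node n ∈ I := ⟨v.2.1.trans (hnode n).1.le, (hnode n).2.le⟩
  let ψ (ω : Ω) : ℝ → ℝ := S.stopped (S.excursion α (extendPath X ω)) (extendPath X ω) |ξ ω|
  refine ⟨fun t ω => ξ ω / |ξ ω| * ψ ω t, fun t => ?_, ?_⟩
  · rcases lt_or_ge t v with htv | hvt
    · have hzero (ω : Ω) : ψ ω t = 0 :=
        S.stopped_eq_zero_of_lt ((Subtype.coe_lt_coe.2 htv).trans (hnode 0).1)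
      simp only [hzero, mul_zero, measurable_const]
    · have hξt : Measurable[𝓕 t] ξ := hξ.mono (𝓕.mono hvt) le_rfl
      have hXt := measurable_extendPath hX t
      have habs : Measurable[𝓕 t] fun ω => |ξ ω| := measurable_abs.comp hξt
      exact (hξt.div habs).mul (S.measurable_stopped
        (fun n j => BlockGrid.measurable_excursion hXt α) hXt habs)
  · filter_upwards [BlockGrid.ae_exists_gain_ge hα0 hS hHolder hball hI
      fun n => hv.1.trans (hnode n).1.le] with ω ⟨⟨C, hω⟩, hgain⟩
    obtain ⟨N, hN⟩ := hgain |ξ ω|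
    have hint := (S.hasIntegral_stopped hα0 hβ0 hβ1 hβ hω hI (abs_nonneg (ξ ω)) hN).const_mul
      (ξ ω / |ξ ω|)
    rw [div_mul_cancel_of_imp fun h => abs_eq_zero.1 h] at hint
    refine hint.congr_ae ?_
    filter_upwards [self_mem_ae_restrict measurableSet_Ioc] with t ht
    rw [extendPath_of_mem (Ioc_subset_Icc_self ht)]

end Paths

end GLS

end

theorem mainTheorem4 {Ω : Type*} [mΩ : MeasurableSpace Ω] (P : Measure Ω) [IsProbabilityMeasure P]
    (𝓕 : Filtration I mΩ) (X : I → Ω → ℝ) (hX : Adapted 𝓕 X)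
    (α : ℝ) (hα : 1 / 2 < α) (hHolder : HolderPaths P X α)
    (δ : ℝ) (hδ : 0 < δ) (hSmall : SmallBall P X α δ)
    (v : I) (hv : (v : ℝ) ∈ Ioo (1 - δ) 1) (hcont : Continuous (cdf (P.map (X v))))
    (F : ℝ → ℝ) (hF : IsDistributionFunction F) :
    ∃ β ∈ Ioo (1 - α) 1, ∃ φ : I → Ω → ℝ, Adapted 𝓕 φ ∧
      ∃ ξ : Ω → ℝ, Measurable ξ ∧
        (∀ᵐ ω ∂P, GLS.HasIntegral β 0 1 (extendPath φ ω) (extendPath X ω) (ξ ω)) ∧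
        ∀ x, cdf (P.map ξ) x = F x := by
  have hXv : Measurable (X v) := (hX v).mono (𝓕.le v) le_rfl
  have := Measure.isProbabilityMeasure_map (μ := P) hXv.aemeasurable
  obtain ⟨ν, _, hν⟩ := GLS.exists_isProbabilityMeasure_cdf_eq hF
  obtain ⟨f, hf, hfν⟩ := GLS.exists_measurable_map_eq_of_continuous_cdf hcont ν
  obtain ⟨β, hβ, hβ1⟩ := exists_between (max_lt zero_lt_one (by linarith : 1 - α < 1))
  obtain ⟨hβ0, hβα⟩ := max_lt_iff.1 hβ
  obtain ⟨φ, hφ, hint⟩ := GLS.exists_adapted_hasIntegral_eq hX hα hβ0 hβ1 hβα hHolder hSmall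
    (Ioo_subset_Ico_self hv) (hf.comp (hX v))
  refine ⟨β, ⟨hβα, hβ1⟩, φ, hφ, f ∘ X v, hf.comp hXv, hint, fun x => ?_⟩
  rw [← Measure.map_map hf hXv, hfν, hν]
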